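/- Let $\Bbbk$ be an arbitrary field. A Hopf brace over $\Bbbk$ is a datum $(H,\cdot,\bullet,1,\Delta,\varepsilon,S,T)$ such that $(H,\cdot,1,\Delta,\varepsilon,S)$ and $(H,\bullet,1,\Delta,\varepsilon,T)$ are Hopf algebras over $\Bbbk$ and $$a\bullet(b\cdot c)=(a_1\bullet b)\cdot S(a_2)\cdot(a_3\bullet c)\qquad\text{for all } a,b,c\in H$$ (in Sweedler notation); it is cocommutative if $\Delta$ is cocommutative. Let $\mathsf{HBR}_{\mathrm{coc}}$ be the category whose objects are the cocommutative Hopf braces over $\Bbbk$ and whose morphisms are the linear maps preserving $\cdot$, $\bullet$, $1$, $\Delta$ and $\varepsilon$. A normal epimorphism is a cokernel of some morphism. Theorem. The category $\mathsf{HBR}_{\mathrm{coc}}$ is homological, that is: (1) it is pointed, i.e. has a zero object; (2) it is regular, i.e. it has finite limits, every morphism factorizes as a regular epimorphism followed by a monomorphism, and regular epimorphisms are stable under pullback; (3) it is protomodular, i.e. the Split Short Five Lemma holds in it: if $f\colon A\to B$, $f'\colon A'\to B'$ have sections $s,s'$ ($fs=\mathrm{Id}_B$, $f's'=\mathrm{Id}_{B'}$)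 and kernels $k\colon K\to A$, $k'\colon K'\to A'$, and if $u\colon K\to K'$, $v\colon A\to A'$, $w\colon B\to B'$ satisfy $vk=k'u$, $wf=f'v$, $vs=s'w$ with $u$ and $w$ isomorphisms, then $v$ is an isomorphism. Moreover, every morphism of $\mathsf{HBR}_{\mathrm{coc}}$ factorizes as a normal epimorphism followed by a monomorphism; the regular epimorphisms coincide with the normal epimorphisms and with the surjective morphisms; and the monomorphisms coincide with the injective morphisms. -/

import Mathlib

open CategoryTheory CategoryTheory.Limits
open scoped TensorProduct

universe v u

noncomputable section

/-- A Hopf brace structure on a Hopf algebra `(H, ·, 1, Δ, ε, S)` over `k`: a second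
multiplication `•` (written `bmul`) and an antipode `T` such that `(H, •, 1, Δ, ε, T)` is again a
Hopf algebra, with the same unit, comultiplication and counit, and such that
`a • (b · c) = (a₁ • b) · S(a₂) · (a₃ • c)`. -/
class HopfBrace (k : Type u) (H : Type v) [Field k] [Ring H] [HopfAlgebra k H] where
  /-- The second multiplication `a • b`. -/
  bmul : H →ₗ[k] H →ₗ[k] H
  /-- The antipode `T` of the second Hopf algebra structure. -/
  bantipode : H →ₗ[k] H
  bmul_assoc : ∀ a b c : H, bmul (bmul a b) c = bmul a (bmul b c)
  one_bmul : ∀ a : H, bmul 1 a = a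
  bmul_one : ∀ a : H, bmul a 1 = a
  /-- `ε(a • b) = ε(a) ε(b)`. -/
  counit_bmul : ∀ a b : H,
    Coalgebra.counit (R := k) (bmul a b) =
      Coalgebra.counit (R := k) a * Coalgebra.counit (R := k) b
  /-- `Δ(a • b) = (a₁ • b₁) ⊗ (a₂ • b₂)`. -/
  comul_bmul : ∀ a b : H,
    Coalgebra.comul (R := k) (bmul a b) =
      TensorProduct.map₂ bmul bmul (Coalgebra.comul (R := k) a) (Coalgebra.comul (R := k) b)
  /-- `T(a₁) • a₂ = ε(a) 1`. -/
  bantipode_bmul : ∀ a : H,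
    TensorProduct.lift bmul (bantipode.rTensor H (Coalgebra.comul (R := k) a)) =
      algebraMap k H (Coalgebra.counit a)
  /-- `a₁ • T(a₂) = ε(a) 1`. -/
  bmul_bantipode : ∀ a : H,
    TensorProduct.lift bmul (bantipode.lTensor H (Coalgebra.comul (R := k) a)) =
      algebraMap k H (Coalgebra.counit a)
  /-- `a • (b · c) = (a₁ • b) · (S(a₂) · (a₃ • c))`, where `a₁ ⊗ (a₂ ⊗ a₃)` is
  `(id ⊗ Δ) (Δ a)`. -/
  bmul_mul : ∀ a b c : H,
    bmul a (b * c) =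
      LinearMap.mul' k H
        (TensorProduct.map (bmul.flip b)
          (LinearMap.mul' k H ∘ₗ TensorProduct.map (HopfAlgebra.antipode k) (bmul.flip c))
          ((Coalgebra.comul (R := k)).lTensor H (Coalgebra.comul (R := k) a)))

/-- The objects of the category of cocommutative Hopf braces over `k`. -/
structure HBRcoc (k : Type u) [Field k] where
  /-- The underlying type. -/
  carrier : Type v
  [ring : Ring carrier]
  [hopfAlgebra : HopfAlgebra k carrier]
  [hopfBrace : HopfBrace k carrier]
  [isCocomm : Coalgebra.IsCocomm k carrier]

namespace HBRcoc

attribute [instance] ring hopfAlgebra hopfBrace isCocomm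

variable {k : Type u} [Field k]

instance : CoeSort (HBRcoc.{v} k) (Type v) := ⟨carrier⟩

/-- Morphisms of Hopf braces: bialgebra maps (linear maps preserving `·`, `1`, `Δ` and `ε`) that
also preserve `•`. Preservation of both antipodes is then automatic. -/
@[ext]
structure Hom (A B : HBRcoc.{v} k) where
  /-- The underlying bialgebra map. -/
  hom : A →ₐc[k] B
  map_bmul : ∀ a b : A,
    hom (HopfBrace.bmul (k := k) a b) = HopfBrace.bmul (k := k) (hom a) (hom b)

instance : Category (HBRcoc.{v} k) where
  Hom A B := Hom A B
  id A := ⟨BialgHom.id k A, fun _ _ => rfl⟩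
  comp f g := ⟨g.hom.comp f.hom, fun a b => by
    simp [f.map_bmul, g.map_bmul]⟩

/-- The zero morphism `a ↦ ε(a) 1`. -/
def zeroHom (A B : HBRcoc.{v} k) : A ⟶ B where
  hom := (Bialgebra.unitBialgHom k B).comp (Bialgebra.counitBialgHom k A)
  map_bmul a b := by
    change algebraMap k B (Coalgebra.counit (R := k) (HopfBrace.bmul (k := k) a b)) =
      HopfBrace.bmul (k := k) (algebraMap k B (Coalgebra.counit (R := k) a))
        (algebraMap k B (Coalgebra.counit (R := k) b))
    simp [HopfBrace.counit_bmul, Algebra.algebraMap_eq_smul_one, HopfBrace.one_bmul, smul_smul,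
      mul_comm]

instance : HasZeroMorphisms (HBRcoc.{v} k) where
  zero A B := ⟨zeroHom A B⟩
  comp_zero {A B} f C := by
    refine Hom.ext (BialgHom.ext fun a => ?_)
    change algebraMap k C (Coalgebra.counit (R := k) (f.hom a)) =
      algebraMap k C (Coalgebra.counit (R := k) a)
    simp
  zero_comp A {B C} f := by
    refine Hom.ext (BialgHom.ext fun a => ?_)
    change f.hom (algebraMap k B (Coalgebra.counit (R := k) a)) =
      algebraMap k C (Coalgebra.counit (R := k) a)
    simp [Algebra.algebraMap_eq_smul_one]

end HBRcoc

/-- The Split Short Five Lemma in a category with zero morphisms: for every morphism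
`(u, v, w)` of split epimorphisms with chosen sections and kernels, if `u` and `w` are
isomorphisms then so is `v`. -/
def SplitShortFiveLemma (C : Type u) [Category.{v} C] [HasZeroMorphisms C] : Prop :=
  ∀ {K A B K' A' B' : C} (k : K ⟶ A) (f : A ⟶ B) (s : B ⟶ A)
    (k' : K' ⟶ A') (f' : A' ⟶ B') (s' : B' ⟶ A')
    (u : K ⟶ K') (v : A ⟶ A') (w : B ⟶ B'),
    s ≫ f = 𝟙 B → s' ≫ f' = 𝟙 B' →
    (∃ h : k ≫ f = 0, Nonempty (IsLimit (KernelFork.ofι k h))) →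
    (∃ h : k' ≫ f' = 0, Nonempty (IsLimit (KernelFork.ofι k' h))) →
    k ≫ v = u ≫ k' → f ≫ w = v ≫ f' → s ≫ v = w ≫ s' →
    IsIso u → IsIso w → IsIso v

/-- A homological category: pointed, regular (in particular finitely complete) and protomodular,
protomodularity of a finitely complete pointed category being the Split Short Five Lemma. -/
structure IsHomological (C : Type u) [Category.{v} C] [HasZeroMorphisms C] : Prop where
  hasZeroObject : HasZeroObject C
  regular : Regular C
  protomodular : SplitShortFiveLemma C

end

/-!
The whole theorem rests on one fact about a surjection `f : A → B` of cocommutative Hopf algebras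
over a field: it has a linear section `s : B → A` which is colinear, that is,
`s(b)₁ ⊗ f(s(b)₂) = s(b₁) ⊗ b₂` (`exists_colinear_section`). It need not respect any product.

*Why colinear sections exist.* The coaction `ρ(a) = a₁ ⊗ f(a₂)` embeds `A` in the cofree comodule
`A ⊗ B`, and a colinear retraction of `ρ` yields `s` after averaging with the antipode. To find the
retraction, choose with Zorn's lemma a subcomodule `N` maximal among those that meet `ρ(A)`
trivially. A linear map `g` that is left inverse to `ρ` and kills `N` induces a colinear
endomorphism `ψ` of `A ⊗ B`, the identity on `ρ(A)`, in whose range `ρ(A)` is essential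
(`IsEssentialIn`). It remains to see that the range of `ψ` is `ρ(A)`. Here the torsor structure
enters: with `K` the Hopf kernel of `f` (`coinv`), the map `a ⊗ b ↦ a b₁ ⊗ b₂` identifies `K ⊗ A`
with the cotensor product of `A` with itself over `B`, so that this cotensor product is a direct
summand of the cofree comodule `A ⊗ A`. As a direct summand it has no proper essential extension,
which forces the range of `ψ` down to `ρ(A)` (`probed_le_of_isEssentialIn`,
`exists_colinear_retraction`). Cocommutativity makes left and right coactions interchangeable.

*Consequences.* Put `κ(c) = S(c₁) s(f(c₂))`, an element of `K`, so that `s(f(c)) = c₁ κ(c₂)`. An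
algebra map that is trivial on `K` therefore takes the same value at `c` and at `s(f(c))`, and so
factors through `f` (`apply_section_of_coinv`).
* Applied to an arbitrary morphism, this shows that a surjective morphism is the cokernel of its
  kernel.
* Applied to the identity of `A`, it shows that a morphism with trivial kernel is injective.
* If `g` is surjective with colinear section `s`, then `s(f(b₁)) ⊗ b₂` lies in the pullback of `g`
  along `f` and projects to `b`; so surjections are stable under pullback.

Finite limits are explicit: products are tensor products, and the equalizer of `f` and `g` consists
of the `a` with `a₁ ⊗ f(a₂) = a₁ ⊗ g(a₂)`. As this condition involves neither product, the same
subspace is a sub-Hopf-algebra for `·` and, by the same argument applied to the Hopf algebra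
`(H, •)` (the type synonym `Circ`), for `•`. Images are set-theoretic images. In the Split Short
Five Lemma, injectivity follows from the trivial kernel, and surjectivity from
`c = (c₁ S(s(f(c₂)))) s(f(c₃))`, whose first factor lies in the kernel of `f`.
-/

noncomputable section

open Coalgebra

namespace HopfColinear

/-! ### Functionals acting on coalgebras -/

section Slices
variable {k V W C D : Type*} [Field k] [AddCommGroup V] [Module k V] [AddCommGroup W] [Module k W]

/-- The slice `v ⊗ c ↦ μ(c) v`. -/
def slice [AddCommGroup C] [Module k C] (V : Type*) [AddCommGroup V] [Module k V]
    (μ : Module.Dual k C) : V ⊗[k] C →ₗ[k] V :=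
  (TensorProduct.rid k V).toLinearMap ∘ₗ μ.lTensor V

@[simp] lemma slice_tmul [AddCommGroup C] [Module k C] (μ : Module.Dual k C) (v : V) (c : C) :
    slice V μ (v ⊗ₜ c) = μ c • v := by simp [slice]

/-- Slices separate the elements of a tensor product over a field. -/
lemma eq_of_slice_eq [AddCommGroup C] [Module k C] {y z : V ⊗[k] C}
    (h : ∀ μ, slice V μ y = slice V μ z) : y = z := by
  classical
  let b := Module.Basis.ofVectorSpace k C
  apply (TensorProduct.equivFinsuppOfBasisRight b).injective
  ext i
  have key : ∀ w : V ⊗[k] C,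
      TensorProduct.equivFinsuppOfBasisRight b w i = slice V (b.coord i) w := by
    intro w
    induction w with
    | zero => simp
    | add x y hx hy => simp [hx, hy]
    | tmul x y => simp
  rw [key, key, h]

lemma slice_rTensor [AddCommGroup C] [Module k C] (μ : Module.Dual k C) (g : V →ₗ[k] W)
    (z : V ⊗[k] C) : slice W μ (g.rTensor C z) = g (slice V μ z) := by
  induction z with
  | zero => simp
  | add x y hx hy => simp only [map_add, hx, hy]
  | tmul x y => simp

lemma slice_lTensor [AddCommGroup C] [Module k C] [AddCommGroup D] [Module k D]
    (μ : Module.Dual k D) (g : C →ₗ[k] D)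
    (z : V ⊗[k] C) : slice V μ (g.lTensor V z) = slice V (μ ∘ₗ g) z := by
  induction z with
  | zero => simp
  | add x y hx hy => simp only [map_add, hx, hy]
  | tmul x y => simp

/-- The slices of a tensor span a finite-dimensional space. -/
lemma exists_fg_slice_mem [AddCommGroup C] [Module k C] (z : V ⊗[k] C) :
    ∃ U : Submodule k V, U.FG ∧ ∀ μ, slice V μ z ∈ U := by
  induction z with
  | zero => exact ⟨⊥, Submodule.fg_bot, by simp⟩
  | add x y hx hy =>
    obtain ⟨U, hU, hU'⟩ := hx
    obtain ⟨W, hW, hW'⟩ := hy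
    refine ⟨U ⊔ W, hU.sup hW, fun μ => ?_⟩
    rw [map_add]
    exact add_mem (Submodule.mem_sup_left (hU' μ)) (Submodule.mem_sup_right (hW' μ))
  | tmul x y =>
    refine ⟨k ∙ x, Submodule.fg_span_singleton x, fun μ => ?_⟩
    rw [slice_tmul]
    exact Submodule.smul_mem _ _ (Submodule.mem_span_singleton_self x)

variable [AddCommGroup C] [Module k C] [Coalgebra k C] [AddCommGroup D] [Module k D]
  [Coalgebra k D]

/-- The action `c ↦ c₁ μ(c₂)` of a functional on a coalgebra. -/
def act (μ : Module.Dual k C) : C →ₗ[k] C := slice C μ ∘ₗ comul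

lemma act_apply (μ : Module.Dual k C) (c : C) : act μ c = slice C μ (comul c) := rfl

@[simp] lemma act_counit : act (counit : Module.Dual k C) = LinearMap.id := by
  ext c
  rw [act_apply]
  simp [slice]

lemma comul_act (μ : Module.Dual k C) (c : C) :
    comul (act μ c) = (act μ).lTensor C (comul (R := k) c) := by
  have h1 : ∀ z : C ⊗[k] C, comul (R := k) (slice C μ z) =
      slice (C ⊗[k] C) μ ((comul (R := k)).rTensor C z) := fun z => by
    rw [slice_rTensor]
  have h2 : ∀ z : C ⊗[k] (C ⊗[k] C), slice (C ⊗[k] C) μ ((TensorProduct.assoc k C C C).symm z) =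
      (slice C μ).lTensor C z := by
    intro z
    induction z with
    | zero => simp
    | add x y hx hy => simp only [map_add, hx, hy]
    | tmul x y =>
      induction y with
      | zero => simp
      | add x y hx hy => simp only [map_add, hx, hy, TensorProduct.tmul_add]
      | tmul y z => simp
  rw [act_apply, h1, ← coassoc_symm_apply, h2, act, LinearMap.lTensor_comp]
  rfl

lemma counit_act (μ : Module.Dual k C) (c : C) : counit (R := k) (act μ c) = μ c := by
  have : ∀ z : C ⊗[k] C, counit (R := k) (slice C μ z) =
      μ (TensorProduct.lid k C ((counit (R := k)).rTensor C z)) := by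
    intro z
    induction z with
    | zero => simp
    | add x y hx hy => simp only [map_add, hx, hy]
    | tmul x y => simp [mul_comm]
  rw [act_apply, this]
  simp

lemma act_comp_act (μ ν : Module.Dual k C) : act μ ∘ₗ act ν = act (μ ∘ₗ act ν) := by
  ext c
  rw [LinearMap.comp_apply, act_apply, comul_act, slice_lTensor]
  rfl

/-- Cocommutativity makes `act μ` left as well as right colinear. -/
lemma comul_act' [IsCocomm k C] (μ : Module.Dual k C) (c : C) :
    comul (act μ c) = (act μ).rTensor C (comul (R := k) c) := by
  rw [← comm_comul k (act μ c), comul_act]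
  conv_rhs => rw [← comm_comul k c]
  have : ∀ z : C ⊗[k] C, TensorProduct.comm k C C ((act μ).lTensor C z) =
      (act μ).rTensor C (TensorProduct.comm k C C z) := by
    intro z
    induction z with
    | zero => simp
    | add x y hx hy => simp only [map_add, hx, hy]
    | tmul x y => simp
  rw [this]

lemma act_comm [IsCocomm k C] (μ ν : Module.Dual k C) (c : C) :
    act μ (act ν c) = act ν (act μ c) := by
  rw [act_apply, comul_act', slice_rTensor]
  rfl

lemma map_act (f : C →ₗc[k] D) (ν : Module.Dual k D) (c : C) :
    f (act (ν ∘ₗ f.toLinearMap) c) = act ν (f c) := by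
  have : ∀ z : C ⊗[k] C, f (slice C (ν ∘ₗ f.toLinearMap) z) =
      slice D ν (TensorProduct.map f.toLinearMap f.toLinearMap z) := by
    intro z
    induction z with
    | zero => simp
    | add x y hx hy => simp only [map_add, hx, hy]
    | tmul x y => simp
  rw [act_apply, this, act_apply]
  congr 1
  exact CoalgHomClass.map_comp_comul_apply f c
end Slices

/-! ### Convolution and the antipode -/

section HopfLemmas
open WithConv HopfAlgebra
variable {k A B : Type*} [Field k] [Ring A] [HopfAlgebra k A] [Ring B]

lemma toConv_algHom_mul_comp_antipode [Algebra k B] (h : A →ₐ[k] B) :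
    toConv h.toLinearMap * toConv (h.toLinearMap ∘ₗ antipode k) = 1 := by
  have := LinearMap.algHom_comp_convMul_distrib h (toConv LinearMap.id) (toConv (antipode k (A := A)))
  rw [LinearMap.id_mul_antipode] at this
  rw [WithConv.ext_iff, LinearMap.comp_id] at *
  rw [← this]
  ext; simp

lemma toConv_comp_antipode_mul_algHom [Algebra k B] (h : A →ₐ[k] B) :
    toConv (h.toLinearMap ∘ₗ antipode k) * toConv h.toLinearMap = 1 := by
  have := LinearMap.algHom_comp_convMul_distrib h (toConv (antipode k (A := A))) (toConv LinearMap.id)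
  rw [LinearMap.antipode_mul_id] at this
  rw [WithConv.ext_iff, LinearMap.comp_id] at *
  rw [← this]
  ext; simp

variable [HopfAlgebra k B]

lemma map_antipode (f : A →ₐc[k] B) (a : A) : f (antipode k a) = antipode k (f a) := by
  have h1 := toConv_algHom_mul_comp_antipode (f : A →ₐ[k] B)
  have h2 : toConv (antipode k (A := B) ∘ₗ (f : A →ₐ[k] B).toLinearMap) *
      toConv (f : A →ₐ[k] B).toLinearMap = 1 := by
    have := LinearMap.convMul_comp_coalgHom_distrib (toConv (antipode k (A := B)))
      (toConv LinearMap.id) (f : A →ₗc[k] B)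
    rw [LinearMap.antipode_mul_id] at this
    refine WithConv.ext (Eq.trans this.symm ?_)
    ext; simp
  have := left_inv_eq_right_inv h2 h1
  exact (LinearMap.congr_fun (WithConv.toConv_injective this) a).symm

/-- As `A` is cocommutative, `Δ` is itself a map of Hopf algebras. -/
lemma comul_antipode [IsCocomm k A] (a : A) :
    comul (antipode k a) = TensorProduct.map (antipode k) (antipode k) (comul (R := k) a) :=
  map_antipode (Bialgebra.comulBialgHom k A) a

lemma antipode_antipode [IsCocomm k A] :
    antipode k ∘ₗ antipode k = (LinearMap.id : A →ₗ[k] A) := by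
  -- both `S ∘ S` and the identity are convolution inverses of `S`
  have h : toConv (antipode k ∘ₗ antipode k : A →ₗ[k] A) * toConv (antipode k) = 1 := by
    ext a
    have := mul_antipode_rTensor_comul_apply (R := k) (antipode k a)
    rw [counit_antipode, comul_antipode] at this
    rw [LinearMap.convOne_apply, ← this, LinearMap.convMul_apply]
    hopf_tensor_induction comul (R := k) a with x y
    simp
  exact congrArg ofConv (left_inv_eq_right_inv h LinearMap.antipode_mul_id)

end HopfLemmas

/-! ### The coaction along a map of Hopf algebras and its Hopf kernel -/

section Coaction
open WithConv HopfAlgebra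
variable {k A B : Type*} [Field k] [Ring A] [HopfAlgebra k A] [Ring B] [HopfAlgebra k B]

/-- The right coaction `a ↦ a₁ ⊗ f(a₂)` of `B` on `A` along a bialgebra map `f`. -/
def coact (f : A →ₐc[k] B) : A →ₐ[k] A ⊗[k] B :=
  (Algebra.TensorProduct.map (AlgHom.id k A) (f : A →ₐ[k] B)).comp (Bialgebra.comulAlgHom k A)

lemma coact_apply (f : A →ₐc[k] B) (a : A) :
    coact f a = (f : A →ₗ[k] B).lTensor A (comul (R := k) a) := rfl

lemma toConv_coact (f : A →ₐc[k] B) : toConv (coact f).toLinearMap =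
    toConv (Algebra.TensorProduct.includeLeft : A →ₐ[k] A ⊗[k] B).toLinearMap *
    toConv ((Algebra.TensorProduct.includeRight : B →ₐ[k] A ⊗[k] B).comp
      (f : A →ₐ[k] B)).toLinearMap := by
  ext a
  rw [LinearMap.convMul_apply]
  simp only [AlgHom.toLinearMap_apply, coact_apply]
  hopf_tensor_induction comul (R := k) a with x y
  simp

/-- `(1 ⊗ f(a₁)) ρ(S(a₂)) = S(a) ⊗ 1`, where `ρ` is the coaction. -/
lemma includeRight_mul_coact_antipode (f : A →ₐc[k] B) (a : A) :
    LinearMap.mul' k (A ⊗[k] B) (TensorProduct.map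
      ((Algebra.TensorProduct.includeRight : B →ₐ[k] A ⊗[k] B).comp (f : A →ₐ[k] B)).toLinearMap
      ((coact f).toLinearMap ∘ₗ antipode k) (comul (R := k) a)) = antipode k a ⊗ₜ 1 := by
  have h : toConv ((Algebra.TensorProduct.includeRight : B →ₐ[k] A ⊗[k] B).comp
      (f : A →ₐ[k] B)).toLinearMap * toConv ((coact f).toLinearMap ∘ₗ antipode k) =
      toConv ((Algebra.TensorProduct.includeLeft : A →ₐ[k] A ⊗[k] B).toLinearMap ∘ₗ antipode k) := by
    have h1 := toConv_algHom_mul_comp_antipode (coact f)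
    have h2 := toConv_comp_antipode_mul_algHom (Algebra.TensorProduct.includeLeft : A →ₐ[k] A ⊗[k] B)
    rw [toConv_coact, mul_assoc] at h1
    exact (left_inv_eq_right_inv h2 h1).symm
  exact LinearMap.congr_fun (WithConv.toConv_injective h) a

@[simp] lemma slice_counit_coact (f : A →ₐc[k] B) (a : A) : slice A counit (coact f a) = a := by
  rw [coact_apply, slice_lTensor]
  have : (counit : B →ₗ[k] k) ∘ₗ (f : A →ₗ[k] B) = counit := by ext; simp
  rw [this, ← act_apply, act_counit, LinearMap.id_apply]

lemma coact_act (f : A →ₐc[k] B) (ν : Module.Dual k B) (a : A) :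
    coact f (act (ν ∘ₗ (f : A →ₗ[k] B)) a) = (act ν).lTensor A (coact f a) := by
  rw [coact_apply, comul_act, ← LinearMap.lTensor_comp_apply, coact_apply,
    ← LinearMap.lTensor_comp_apply]
  congr 2
  ext a
  exact map_act (f : A →ₗc[k] B) ν a

/-- The Hopf kernel of `f`: the elements with `a₁ ⊗ f(a₂) = a ⊗ 1`, as a subspace. -/
def coinv (f : A →ₐc[k] B) : Submodule k A :=
  LinearMap.eqLocus (coact f).toLinearMap
    (Algebra.TensorProduct.includeLeft : A →ₐ[k] A ⊗[k] B).toLinearMap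

lemma mem_coinv {f : A →ₐc[k] B} {a : A} : a ∈ coinv f ↔ coact f a = a ⊗ₜ 1 := Iff.rfl

variable (k A) in
/-- The left `A`-linear map `a ⊗ b ↦ a S(b₁) ⊗ b₂`. -/
def untwist : A ⊗[k] A →ₗ[k] A ⊗[k] A :=
  LinearMap.mul' k (A ⊗[k] A) ∘ₗ TensorProduct.map
    (Algebra.TensorProduct.includeLeft : A →ₐ[k] A ⊗[k] A).toLinearMap
    ((antipode k).rTensor A ∘ₗ comul)

variable (k A) in
/-- The left `A`-linear map `a ⊗ b ↦ a b₁ ⊗ b₂`. -/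
def twist : A ⊗[k] A →ₗ[k] A ⊗[k] A :=
  LinearMap.mul' k (A ⊗[k] A) ∘ₗ TensorProduct.map
    (Algebra.TensorProduct.includeLeft : A →ₐ[k] A ⊗[k] A).toLinearMap comul

lemma untwist_tmul (a b : A) : untwist k A (a ⊗ₜ b) =
    (a ⊗ₜ 1) * (antipode k).rTensor A (comul (R := k) b) := rfl

lemma twist_tmul (a b : A) : twist k A (a ⊗ₜ b) = (a ⊗ₜ 1) * comul (R := k) b := rfl

lemma twist_untwist (x : A ⊗[k] A) : twist k A (untwist k A x) = x := by
  have h1 : ∀ (a : A) (z : A ⊗[k] A), twist k A ((a ⊗ₜ 1) * z) = (a ⊗ₜ 1) * twist k A z := by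
    intro a z
    induction z with
    | zero => simp
    | add x y hx hy => simp only [mul_add, map_add, hx, hy]
    | tmul x y =>
      rw [Algebra.TensorProduct.tmul_mul_tmul, one_mul, twist_tmul, twist_tmul, ← mul_assoc,
        Algebra.TensorProduct.tmul_mul_tmul, one_mul]
  have h2 : ∀ z : A ⊗[k] A, twist k A ((antipode k).rTensor A z) =
      (LinearMap.mul' k A ∘ₗ (antipode k).rTensor A).rTensor A
        ((TensorProduct.assoc k A A A).symm (comul.lTensor A z)) := by
    intro z
    induction z with
    | zero => simp
    | add x y hx hy => simp only [map_add, hx, hy]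
    | tmul x y =>
      simp only [LinearMap.rTensor_tmul, LinearMap.lTensor_tmul, twist_tmul]
      hopf_tensor_induction comul (R := k) y with y z
      simp
  induction x with
  | zero => simp
  | add x y hx hy => simp only [map_add, hx, hy]
  | tmul a b =>
    rw [untwist_tmul, h1, h2, coassoc_symm_apply, ← LinearMap.rTensor_comp_apply]
    have : (LinearMap.mul' k A ∘ₗ (antipode k).rTensor A) ∘ₗ comul =
        Algebra.linearMap k A ∘ₗ counit := mul_antipode_rTensor_comul
    rw [this, LinearMap.rTensor_comp_apply, rTensor_counit_comul]
    simp

lemma untwist_lTensor_act (μ : Module.Dual k A) (x : A ⊗[k] A) :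
    untwist k A ((act μ).lTensor A x) = (act μ).lTensor A (untwist k A x) := by
  induction x with
  | zero => simp
  | add x y hx hy => simp only [map_add, hx, hy]
  | tmul a b =>
    rw [LinearMap.lTensor_tmul, untwist_tmul, untwist_tmul, comul_act]
    hopf_tensor_induction comul (R := k) b with x y
    simp

lemma twist_lTensor_act (μ : Module.Dual k A) (x : A ⊗[k] A) :
    twist k A ((act μ).lTensor A x) = (act μ).lTensor A (twist k A x) := by
  induction x with
  | zero => simp
  | add x y hx hy => simp only [map_add, hx, hy]
  | tmul a b =>
    rw [LinearMap.lTensor_tmul, twist_tmul, twist_tmul, comul_act]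
    hopf_tensor_induction comul (R := k) b with x y
    simp

lemma slice_untwist (μ : Module.Dual k A) (x : A ⊗[k] A) :
    slice A μ (untwist k A x) =
      LinearMap.mul' k A ((antipode k).lTensor A ((act μ).lTensor A x)) := by
  induction x with
  | zero => simp
  | add x y hx hy => simp only [map_add, hx, hy]
  | tmul a b =>
    rw [LinearMap.lTensor_tmul, untwist_tmul, act_apply]
    hopf_tensor_induction comul (R := k) b with x y
    simp

/-- The maps `a ⊗ b ↦ a ⊗ f(b₁) μ(b₂)`, which are the slices of
`a ⊗ b ↦ a ⊗ f(b₁) ⊗ b₂`. -/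
def probe (f : A →ₐc[k] B) (μ : Module.Dual k A) : A ⊗[k] A →ₗ[k] A ⊗[k] B :=
  ((f : A →ₗ[k] B) ∘ₗ act μ).lTensor A

lemma slice_counit_probe (f : A →ₐc[k] B) (μ : Module.Dual k A) (x : A ⊗[k] A) :
    slice A counit (probe f μ x) = slice A μ x := by
  rw [probe, slice_lTensor]
  congr 1
  congr 1
  ext a
  simp [counit_act]

lemma probe_lTensor_act [IsCocomm k A] (f : A →ₐc[k] B) (μ : Module.Dual k A)
    (ν : Module.Dual k B) (x : A ⊗[k] A) :
    probe f μ ((act (ν ∘ₗ (f : A →ₗ[k] B))).lTensor A x) = (act ν).lTensor A (probe f μ x) := by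
  rw [probe, ← LinearMap.lTensor_comp_apply, ← LinearMap.lTensor_comp_apply]
  congr 2
  ext a
  simp only [LinearMap.comp_apply]
  rw [act_comm]
  exact map_act (f : A →ₗc[k] B) ν _

/-- The `x` all of whose probes lie in `E`. For `E` the image of the coaction `ρ` this is the
cotensor product of `A` with itself over `B`, the space of `Σ x ⊗ y` with
`Σ x₁ ⊗ f(x₂) ⊗ y = Σ x ⊗ f(y₁) ⊗ y₂`. -/
def probed (f : A →ₐc[k] B) (E : Submodule k (A ⊗[k] B)) : Submodule k (A ⊗[k] A) :=
  ⨅ μ, E.comap (probe f μ)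

lemma mem_probed {f : A →ₐc[k] B} {E : Submodule k (A ⊗[k] B)} {x : A ⊗[k] A} :
    x ∈ probed f E ↔ ∀ μ, probe f μ x ∈ E := by simp [probed]

/-- The condition defining the cotensor product, slice by slice. -/
lemma probe_of_mem {f : A →ₐc[k] B} {x : A ⊗[k] A}
    (hx : x ∈ probed f (LinearMap.range (coact f).toLinearMap)) (μ : Module.Dual k A) :
    probe f μ x = coact f (slice A μ x) := by
  obtain ⟨y, hy⟩ := mem_probed.1 hx μ
  rw [← slice_counit_probe f, ← hy]
  simp

lemma lTensor_act_mem_probed [IsCocomm k A] {f : A →ₐc[k] B}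
    {x : A ⊗[k] A} (hx : x ∈ probed f (LinearMap.range (coact f).toLinearMap))
    (μ : Module.Dual k A) :
    (act μ).lTensor A x ∈ probed f (LinearMap.range (coact f).toLinearMap) := by
  refine mem_probed.2 fun ν => ?_
  have : probe f ν ((act μ).lTensor A x) = probe f (ν ∘ₗ act μ) x := by
    rw [probe, probe, ← LinearMap.lTensor_comp_apply, LinearMap.comp_assoc, act_comp_act]
  rw [this]
  exact mem_probed.1 hx _

/-- If `Σ x ⊗ y` lies in the cotensor product then `Σ x S(y)` lies in the Hopf kernel. -/
lemma mul_antipode_mem_coinv {f : A →ₐc[k] B} {x : A ⊗[k] A}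
    (hx : x ∈ probed f (LinearMap.range (coact f).toLinearMap)) :
    LinearMap.mul' k A ((antipode k).lTensor A x) ∈ coinv f := by
  have h1 : (coact f).toLinearMap.rTensor A x =
      (TensorProduct.assoc k A B A).symm
        (((f : A →ₗ[k] B).rTensor A ∘ₗ comul).lTensor A x) := by
    refine eq_of_slice_eq fun μ => ?_
    rw [slice_rTensor]
    change coact f _ = _
    rw [← probe_of_mem hx]
    clear hx
    induction x with
    | zero => simp
    | add x y hx hy => simp only [map_add, hx, hy]
    | tmul a b =>
      simp only [probe, LinearMap.lTensor_tmul, LinearMap.comp_apply, act_apply]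
      hopf_tensor_induction comul (R := k) b with x y
      simp
  have h2 := congrArg (LinearMap.mul' k (A ⊗[k] B) ∘ₗ
    ((coact f).toLinearMap ∘ₗ antipode k).lTensor (A ⊗[k] B)) h1
  rw [mem_coinv]
  refine Eq.trans ?_ (h2.trans ?_)
  · clear h1 h2 hx
    induction x with
    | zero => simp
    | add x y hx hy => simp only [map_add, hx, hy]
    | tmul a b => simp
  · clear h1 h2 hx
    induction x with
    | zero => simp
    | add x y hx hy => simp only [map_add, hx, hy, TensorProduct.add_tmul]
    | tmul a b =>
      have := congrArg ((a ⊗ₜ[k] (1 : B)) * ·) (includeRight_mul_coact_antipode f b)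
      simp only [Algebra.TensorProduct.tmul_mul_tmul, one_mul] at this
      simp only [LinearMap.lTensor_tmul, LinearMap.mul'_apply]
      rw [← this]
      simp only [LinearMap.comp_apply]
      hopf_tensor_induction comul (R := k) b with x y
      simp [← mul_assoc]

lemma probe_twist (f : A →ₐc[k] B) (μ : Module.Dual k A) (a b : A) :
    probe f μ (twist k A (a ⊗ₜ b)) = (a ⊗ₜ 1) * coact f (act μ b) := by
  rw [twist_tmul, coact_apply, comul_act, probe]
  hopf_tensor_induction comul (R := k) b with x y
  simp

/-- `twist` maps `K ⊗ A`, with `K` the Hopf kernel, into the cotensor product. -/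
lemma twist_mem_probed {f : A →ₐc[k] B} {p : A →ₗ[k] A} (hp : ∀ a, p a ∈ coinv f)
    (x : A ⊗[k] A) :
    twist k A (p.rTensor A x) ∈ probed f (LinearMap.range (coact f).toLinearMap) := by
  induction x with
  | zero => simp
  | add x y hx hy => simpa only [map_add] using add_mem hx hy
  | tmul a b =>
    refine mem_probed.2 fun μ => ?_
    rw [LinearMap.rTensor_tmul, probe_twist, ← mem_coinv.1 (hp a), ← map_mul]
    exact ⟨_, rfl⟩

end Coaction

/-! ### Essential extensions of comodules and colinear retractions -/

section Retraction
open WithConv HopfAlgebra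
variable {k A B : Type*} [Field k] [Ring A] [HopfAlgebra k A] [Ring B] [HopfAlgebra k B]

/-- A subspace of `V ⊗ C` is stable if it is a subcomodule of the cofree comodule `V ⊗ C`; over a
field this is stability under the functionals on `C`. -/
def IsStable {V C : Type*} [AddCommGroup V] [Module k V] [AddCommGroup C] [Module k C]
    [Coalgebra k C] (E : Submodule k (V ⊗[k] C)) : Prop :=
  ∀ (ν : Module.Dual k C), ∀ e ∈ E, (act ν).lTensor V e ∈ E

/-- `M` is essential in `E`: each nonzero element of `E` generates a subcomodule meeting `M`. -/
def IsEssentialIn {V C : Type*} [AddCommGroup V] [Module k V] [AddCommGroup C] [Module k C]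
    [Coalgebra k C] (M E : Submodule k (V ⊗[k] C)) : Prop :=
  ∀ e ∈ E, e ≠ 0 → ∃ ν : Module.Dual k C, (act ν).lTensor V e ∈ M ∧ (act ν).lTensor V e ≠ 0

section Comodule
variable {V C : Type*} [AddCommGroup V] [Module k V] [AddCommGroup C] [Module k C]
    [Coalgebra k C]

lemma act_add (μ ν : Module.Dual k C) : act (μ + ν) = act μ + act ν := by
  ext a; simp [act, slice]

lemma act_smul (c : k) (μ : Module.Dual k C) : act (c • μ) = c • act μ := by
  ext a; simp [act, slice]

lemma lTensor_act_act (μ ν : Module.Dual k C) (x : V ⊗[k] C) :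
    (act μ).lTensor V ((act ν).lTensor V x) = (act (μ ∘ₗ act ν)).lTensor V x := by
  rw [← act_comp_act, LinearMap.lTensor_comp_apply]

lemma lTensor_act_counit (x : V ⊗[k] C) :
    (act (counit : Module.Dual k C)).lTensor V x = x := by simp

/-- A single functional carries a whole finite set into `M` without killing it. -/
lemma IsEssentialIn.exists_finset {M E : Submodule k (V ⊗[k] C)} (h : IsEssentialIn M E)
    (hM : IsStable M) (hE : IsStable E) (s : Finset (V ⊗[k] C)) (hs : ∀ e ∈ s, e ∈ E)
    (hs0 : ∃ e ∈ s, e ≠ 0) :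
    ∃ ν : Module.Dual k C, (∀ e ∈ s, (act ν).lTensor V e ∈ M) ∧
      ∃ e ∈ s, (act ν).lTensor V e ≠ 0 := by
  classical
  induction s using Finset.induction_on with
  | empty => simp at hs0
  | insert a s _ ih =>
    by_cases hs1 : ∃ e ∈ s, e ≠ 0
    -- a functional `ν` that works for `s` either carries `a` into `M` or keeps it nonzero; in the
    -- second case it is corrected by one that carries `ν a` into `M`
    · obtain ⟨ν, h1, e, he, he0⟩ := ih (fun e he => hs e (Finset.mem_insert_of_mem he)) hs1
      by_cases ha : (act ν).lTensor V a ∈ M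
      · refine ⟨ν, ?_, e, Finset.mem_insert_of_mem he, he0⟩
        intro x hx
        rcases Finset.mem_insert.1 hx with rfl | hx
        exacts [ha, h1 x hx]
      · obtain ⟨μ, hμ, hμ0⟩ := h _ (hE ν a (hs a (Finset.mem_insert_self _ _)))
          (fun h0 => ha (h0 ▸ zero_mem M))
        refine ⟨μ ∘ₗ act ν, ?_, a, Finset.mem_insert_self _ _, ?_⟩
        · intro x hx
          rw [← lTensor_act_act]
          rcases Finset.mem_insert.1 hx with rfl | hx
          exacts [hμ, hM _ _ (h1 x hx)]
        · rwa [← lTensor_act_act]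
    · push Not at hs1
      have ha : a ≠ 0 := by
        obtain ⟨e, he, he0⟩ := hs0
        rcases Finset.mem_insert.1 he with rfl | he
        exacts [he0, absurd (hs1 e he) he0]
      obtain ⟨ν, hν, hν0⟩ := h a (hs a (Finset.mem_insert_self _ _)) ha
      refine ⟨ν, ?_, a, Finset.mem_insert_self _ _, hν0⟩
      intro x hx
      rcases Finset.mem_insert.1 hx with rfl | hx
      · exact hν
      · rw [hs1 x hx, map_zero]; exact zero_mem M

lemma IsEssentialIn.exists_of_fg {M E : Submodule k (V ⊗[k] C)} (h : IsEssentialIn M E)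
    (hM : IsStable M) (hE : IsStable E) (U : Submodule k (V ⊗[k] C)) (hU : U.FG) (hUE : U ≤ E)
    (hU0 : U ≠ ⊥) :
    ∃ ν : Module.Dual k C, (∀ e ∈ U, (act ν).lTensor V e ∈ M) ∧
      ∃ e ∈ U, (act ν).lTensor V e ≠ 0 := by
  obtain ⟨s, rfl⟩ := hU
  obtain ⟨ν, h1, e, he, he0⟩ := h.exists_finset hM hE s (fun e he => hUE (Submodule.subset_span he))
    (by
      by_contra! h0
      exact hU0 (Submodule.span_eq_bot.2 fun x hx => h0 x hx))
  refine ⟨ν, fun x hx => ?_, e, Submodule.subset_span he, he0⟩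
  have : Submodule.span k (s : Set (V ⊗[k] C)) ≤ M.comap ((act ν).lTensor V) :=
    Submodule.span_le.2 h1
  exact this hx

variable (V) in
/-- The map `ν ↦ (id ⊗ ν ⇀) x`, whose range is the subcomodule generated by `x`. -/
def orbitMap (x : V ⊗[k] C) : Module.Dual k C →ₗ[k] V ⊗[k] C where
  toFun ν := (act ν).lTensor V x
  map_add' μ ν := by rw [act_add, LinearMap.lTensor_add, LinearMap.add_apply]
  map_smul' c μ := by rw [act_smul, LinearMap.lTensor_smul, LinearMap.smul_apply, RingHom.id_apply]

lemma orbitMap_apply (x : V ⊗[k] C) (ν : Module.Dual k C) :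
    orbitMap V x ν = (act ν).lTensor V x := rfl

/-- The colinear map `V ⊗ C → W ⊗ C`, `x ⊗ c ↦ g(x ⊗ c₁) ⊗ c₂`, induced by a linear map
`g : V ⊗ C → W`. -/
def cofreeLift {W : Type*} [AddCommGroup W] [Module k W] (g : V ⊗[k] C →ₗ[k] W) :
    V ⊗[k] C →ₗ[k] W ⊗[k] C :=
  g.rTensor C ∘ₗ (TensorProduct.assoc k V C C).symm.toLinearMap ∘ₗ comul.lTensor V

variable {W : Type*} [AddCommGroup W] [Module k W]

lemma slice_cofreeLift (g : V ⊗[k] C →ₗ[k] W) (ν : Module.Dual k C) (x : V ⊗[k] C) :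
    slice W ν (cofreeLift g x) = g ((act ν).lTensor V x) := by
  simp only [cofreeLift, LinearMap.comp_apply]
  rw [slice_rTensor]
  congr 1
  induction x with
  | zero => simp
  | add x y hx hy => simp only [map_add, hx, hy]
  | tmul a b =>
    simp only [LinearMap.lTensor_tmul, act_apply]
    hopf_tensor_induction comul (R := k) b with x y
    simp

lemma slice_act (μ ν : Module.Dual k C) (w : W ⊗[k] C) :
    slice W μ ((act ν).lTensor W w) = slice W (μ ∘ₗ act ν) w := by
  rw [slice_lTensor]

lemma cofreeLift_act (g : V ⊗[k] C →ₗ[k] W) (ν : Module.Dual k C) (x : V ⊗[k] C) :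
    cofreeLift g ((act ν).lTensor V x) = (act ν).lTensor W (cofreeLift g x) := by
  refine eq_of_slice_eq fun μ => ?_
  rw [slice_act, slice_cofreeLift, slice_cofreeLift, lTensor_act_act]

lemma isStable_range_cofreeLift (g : V ⊗[k] C →ₗ[k] W) :
    IsStable (LinearMap.range (cofreeLift g)) := by
  rintro ν _ ⟨x, rfl⟩
  exact ⟨_, cofreeLift_act g ν x⟩

/-- Zorn's lemma for the subcomodules that meet `M` trivially. -/
lemma exists_maximal_isStable (M : Submodule k (V ⊗[k] C)) :
    ∃ N : Submodule k (V ⊗[k] C), IsStable N ∧ Disjoint N M ∧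
      ∀ N' : Submodule k (V ⊗[k] C), IsStable N' → N ≤ N' → Disjoint N' M → N' ≤ N := by
  obtain ⟨N, hN⟩ := zorn_le₀ {N : Submodule k (V ⊗[k] C) | IsStable N ∧ Disjoint N M} (by
    intro c hc hchain
    rcases c.eq_empty_or_nonempty with rfl | hne
    · exact ⟨⊥, ⟨fun ν e he => by
        rw [(Submodule.mem_bot k).1 he, map_zero]; exact zero_mem _, disjoint_bot_left⟩, by simp⟩
    · refine ⟨sSup c, ⟨fun ν e he => ?_, ?_⟩, fun z hz => le_sSup hz⟩
      · obtain ⟨N, hN, heN⟩ := (Submodule.mem_sSup_of_directed hne hchain.directedOn).1 he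
        exact (le_sSup hN : N ≤ sSup c) ((hc hN).1 ν e heN)
      · rw [Submodule.disjoint_def]
        intro x hx hxM
        obtain ⟨N, hN, hxN⟩ := (Submodule.mem_sSup_of_directed hne hchain.directedOn).1 hx
        exact Submodule.disjoint_def.1 (hc hN).2 x hxN hxM)
  exact ⟨N, hN.1.1, hN.1.2, fun N' h1 h2 h3 => hN.2 ⟨h1, h3⟩ h2⟩

end Comodule

lemma coact_stable (f : A →ₐc[k] B) :
    IsStable (LinearMap.range (coact f).toLinearMap) := by
  rintro ν _ ⟨a, rfl⟩
  exact ⟨_, coact_act f ν a⟩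

/-- `untwist` maps the cotensor product into `K ⊗ A`, with `K` the Hopf kernel. -/
lemma rTensor_untwist {f : A →ₐc[k] B} [IsCocomm k A] {p : A →ₗ[k] A}
    (hp : ∀ a ∈ coinv f, p a = a) {x : A ⊗[k] A}
    (hx : x ∈ probed f (LinearMap.range (coact f).toLinearMap)) :
    p.rTensor A (untwist k A x) = untwist k A x := by
  refine eq_of_slice_eq fun μ => ?_
  rw [slice_rTensor, slice_untwist]
  exact hp _ (mul_antipode_mem_coinv (lTensor_act_mem_probed hx μ))

/-- If the image of the coaction is essential in `E`, then passing from that image to `E` does not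
enlarge the space of elements whose probes lie in it: the cotensor product is a direct summand of
`A ⊗ A` as a comodule, because it corresponds to `K ⊗ A` under `untwist`. -/
lemma probed_le_of_isEssentialIn [IsCocomm k A] (f : A →ₐc[k] B)
    {E : Submodule k (A ⊗[k] B)} (hE : IsStable E)
    (hME : LinearMap.range (coact f).toLinearMap ≤ E)
    (hess : IsEssentialIn (LinearMap.range (coact f).toLinearMap) E) :
    probed f E ≤ probed f (LinearMap.range (coact f).toLinearMap) := by
  obtain ⟨p, hp⟩ := (coinv f).subtype.exists_leftInverse_of_injective
    (LinearMap.ker_eq_bot.2 (coinv f).injective_subtype)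
  set P : A →ₗ[k] A := (coinv f).subtype ∘ₗ p
  have hP1 : ∀ a, P a ∈ coinv f := fun a => (p a).2
  have hP2 : ∀ a ∈ coinv f, P a = a := fun a ha =>
    congrArg Subtype.val (LinearMap.congr_fun hp ⟨a, ha⟩)
  -- a colinear projection of `A ⊗ A` onto the cotensor product
  let r : A ⊗[k] A →ₗ[k] A ⊗[k] A := twist k A ∘ₗ P.rTensor A ∘ₗ untwist k A
  have hr1 : ∀ x, r x ∈ probed f (LinearMap.range (coact f).toLinearMap) :=
    fun x => twist_mem_probed hP1 _
  have hr2 : ∀ x ∈ probed f (LinearMap.range (coact f).toLinearMap), r x = x := by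
    intro x hx
    simp only [r, LinearMap.comp_apply, rTensor_untwist hP2 hx, twist_untwist]
  have hr3 : ∀ μ x, r ((act μ).lTensor A x) = (act μ).lTensor A (r x) := by
    intro μ x
    simp only [r, LinearMap.comp_apply, untwist_lTensor_act]
    rw [← twist_lTensor_act, ← LinearMap.comp_apply (P.rTensor A), ← LinearMap.comp_apply
      (LinearMap.lTensor A (act μ)), LinearMap.rTensor_comp_lTensor, LinearMap.lTensor_comp_rTensor]
  -- the probes of a nonzero `x` span a finite-dimensional nonzero subspace of `E`; a functional
  -- carrying it into the image of the coaction carries `x` into the cotensor product, where `r` is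
  -- the identity, so `r x ≠ 0`
  have hr4 : ∀ x ∈ probed f E, r x = 0 → x = 0 := by
    intro x hx hrx
    by_contra hx0
    let Φ : Module.Dual k A →ₗ[k] A ⊗[k] B :=
      { toFun := fun μ => probe f μ x
        map_add' := fun μ ν => by
          rw [probe, act_add, LinearMap.comp_add, LinearMap.lTensor_add]; rfl
        map_smul' := fun c μ => by
          rw [probe, act_smul, LinearMap.comp_smul, LinearMap.lTensor_smul]; rfl }
    have hfg : (LinearMap.range Φ).FG := by
      obtain ⟨U, hU, hU'⟩ := exists_fg_slice_mem ((TensorProduct.assoc k A B A).symm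
        (((f : A →ₗ[k] B).rTensor A ∘ₗ comul).lTensor A x))
      have : FiniteDimensional k U := Module.Finite.iff_fg.2 hU
      have hle : LinearMap.range Φ ≤ U := by
        rintro _ ⟨μ, rfl⟩
        convert hU' μ
        change probe f μ x = _
        clear hx hrx hx0 Φ hU'
        induction x with
        | zero => simp
        | add x y hx hy => simp only [map_add, hx, hy]
        | tmul a b =>
          simp only [probe, LinearMap.lTensor_tmul, LinearMap.comp_apply, act_apply]
          hopf_tensor_induction comul (R := k) b with x y
          simp
      exact Submodule.FG.of_le hU hle
    obtain ⟨ν, h1, e, ⟨μ, rfl⟩, h2⟩ := hess.exists_of_fg (coact_stable f) hE (LinearMap.range Φ) hfg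
      (by rintro _ ⟨μ, rfl⟩; exact mem_probed.1 hx μ)
      (by
        intro hbot
        apply hx0
        refine eq_of_slice_eq fun μ => ?_
        rw [← slice_counit_probe f]
        have : Φ μ = 0 := (Submodule.mem_bot k).1 (hbot ▸ ⟨μ, rfl⟩)
        change slice A counit (Φ μ) = _
        rw [this, map_zero, map_zero])
    change (act ν).lTensor A (probe f μ x) ≠ 0 at h2
    have h3 : (act (ν ∘ₗ (f : A →ₗ[k] B))).lTensor A x ∈
        probed f (LinearMap.range (coact f).toLinearMap) :=
      mem_probed.2 fun μ' => by
        rw [probe_lTensor_act]; exact h1 _ ⟨μ', rfl⟩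
    rw [← probe_lTensor_act, ← hr2 _ h3, hr3, hrx] at h2
    simp at h2
  have hle : probed f (LinearMap.range (coact f).toLinearMap) ≤ probed f E := fun x hx =>
    mem_probed.2 fun μ => hME (mem_probed.1 hx μ)
  intro x hx
  have := hr4 (x - r x) (sub_mem hx (hle (hr1 x))) (by rw [map_sub, hr2 _ (hr1 x), sub_self])
  rw [sub_eq_zero.1 this]
  exact hr1 x

/-- The coaction along a surjection `f` of cocommutative Hopf algebras over a field embeds `A` as a
direct summand of the cofree comodule `A ⊗ B`. -/
theorem exists_colinear_retraction [IsCocomm k A] (f : A →ₐc[k] B) (hf : Function.Surjective f) :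
    ∃ g : A ⊗[k] B →ₗ[k] A, (∀ a, g (coact f a) = a) ∧ ∀ x, coact f (g x) = cofreeLift g x := by
  obtain ⟨N, hN, hNM, hmax⟩ := exists_maximal_isStable (LinearMap.range (coact f).toLinearMap)
  obtain ⟨g₀, hg₀⟩ := (N.mkQ ∘ₗ (coact f).toLinearMap).exists_leftInverse_of_injective (by
    rw [LinearMap.ker_eq_bot']
    intro a ha
    have h0 := Submodule.disjoint_def.1 hNM (coact f a)
      ((Submodule.Quotient.mk_eq_zero N).1 ha) ⟨a, rfl⟩
    rw [← slice_counit_coact f a, h0, map_zero])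
  let g : A ⊗[k] B →ₗ[k] A := g₀ ∘ₗ N.mkQ
  have hg : ∀ a, g (coact f a) = a := fun a => LinearMap.congr_fun hg₀ a
  have hgN : ∀ n ∈ N, g n = 0 := fun n hn => by
    simp only [g, LinearMap.comp_apply, Submodule.mkQ_apply, (Submodule.Quotient.mk_eq_zero N).2 hn,
      map_zero]
  -- `ψ = cofreeLift g` is the identity on the image of the coaction and zero on `N`
  have hψ : ∀ a, cofreeLift g (coact f a) = coact f a := fun a => by
    refine eq_of_slice_eq fun ν => ?_
    rw [slice_cofreeLift, ← coact_act, hg, act_apply, coact_apply, slice_lTensor]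
  have hψN : ∀ n ∈ N, cofreeLift g n = 0 := fun n hn => by
    refine eq_of_slice_eq fun ν => ?_
    rw [slice_cofreeLift, hgN _ (hN ν n hn), map_zero]
  -- if `ψ x ≠ 0` then `x ∉ N`, so by maximality `N` and `x` together generate a subcomodule that
  -- meets the image of the coaction; applying `ψ` removes the component in `N`
  have hess : IsEssentialIn (LinearMap.range (coact f).toLinearMap)
      (LinearMap.range (cofreeLift g)) := by
    rintro _ ⟨x, rfl⟩ hx
    have hY : IsStable (N ⊔ LinearMap.range (orbitMap A x)) := by
      intro ν e he
      obtain ⟨n, hn, _, ⟨μ, rfl⟩, rfl⟩ := Submodule.mem_sup.1 he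
      rw [map_add]
      refine add_mem (Submodule.mem_sup_left (hN ν n hn)) (Submodule.mem_sup_right ⟨ν ∘ₗ act μ, ?_⟩)
      rw [orbitMap_apply, orbitMap_apply, lTensor_act_act]
    have hYM : ¬ Disjoint (N ⊔ LinearMap.range (orbitMap A x))
        (LinearMap.range (coact f).toLinearMap) := by
      intro hdis
      refine hx (hψN x (hmax _ hY le_sup_left hdis (Submodule.mem_sup_right ⟨counit, ?_⟩)))
      rw [orbitMap_apply, lTensor_act_counit]
    rw [Submodule.disjoint_def] at hYM
    push Not at hYM
    obtain ⟨m, hm, ⟨a, rfl⟩, hm0⟩ := hYM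
    obtain ⟨n, hn, _, ⟨μ, rfl⟩, hsum⟩ := Submodule.mem_sup.1 hm
    have hm' : (act μ).lTensor A (cofreeLift g x) = coact f a := by
      have := congrArg (cofreeLift g) hsum
      rw [map_add, hψN n hn, zero_add, orbitMap_apply, cofreeLift_act] at this
      exact this.trans (hψ a)
    exact ⟨μ, hm' ▸ ⟨a, rfl⟩, hm' ▸ hm0⟩
  have hE := isStable_range_cofreeLift g
  have hle : LinearMap.range (coact f).toLinearMap ≤ LinearMap.range (cofreeLift g) := by
    rintro _ ⟨a, rfl⟩
    exact ⟨_, hψ a⟩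
  have hprobed := probed_le_of_isEssentialIn f hE hle hess
  -- colinearity of `g` says that `ψ e` is in the image of the coaction
  refine ⟨g, hg, fun e => ?_⟩
  -- lift `e` to `x` in `A ⊗ A` and apply `g` to the first two factors of `a ⊗ f(b₁) ⊗ b₂`;
  -- the probes of the result `x'` are the images under `ψ` of those of `x`, so they lie in
  -- the range of `ψ`
  obtain ⟨x, rfl⟩ := LinearMap.lTensor_surjective A (g := (f : A →ₗ[k] B)) hf e
  set x' := g.rTensor A ((TensorProduct.assoc k A B A).symm
    (((f : A →ₗ[k] B).rTensor A ∘ₗ comul).lTensor A x)) with hx'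
  have hpr : ∀ μ, probe f μ x' = cofreeLift g (probe f μ x) := by
    intro μ
    rw [hx']
    clear hx' x'
    induction x with
    | zero => simp
    | add x y hx hy => simp only [map_add, hx, hy]
    | tmul a b =>
      have h : comul (R := k) (f (act μ b)) =
          TensorProduct.map (f : A →ₗ[k] B) ((f : A →ₗ[k] B) ∘ₗ act μ) (comul (R := k) b) := by
        rw [← CoalgHomClass.map_comp_comul_apply f, comul_act]
        hopf_tensor_induction comul (R := k) b with x y
        simp
      simp only [probe, cofreeLift, LinearMap.lTensor_tmul, LinearMap.comp_apply]
      erw [h]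
      hopf_tensor_induction comul (R := k) b with x y
      simp
  have hmem : x' ∈ probed f (LinearMap.range (coact f).toLinearMap) :=
    hprobed (mem_probed.2 fun μ => ⟨_, (hpr μ).symm⟩)
  have h1 := (hpr counit).symm.trans (probe_of_mem hmem counit)
  have h2 : probe f counit x = (f : A →ₗ[k] B).lTensor A x := by
    rw [probe, act_counit, LinearMap.comp_id]
  rw [h2] at h1
  rw [h1]
  congr 1
  have h3 := congrArg (slice A counit) h1
  rwa [slice_cofreeLift, lTensor_act_counit, slice_counit_coact] at h3
end Retraction

/-! ### Colinear sections -/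

section ColinearSection
open WithConv HopfAlgebra
variable {k A B : Type*} [Field k] [Ring A] [HopfAlgebra k A] [Ring B] [HopfAlgebra k B]

/-- The map `a ⊗ b ↦ a₁ φ(S(f(a₂)) b)`. -/
def averaged (f : A →ₐc[k] B) (φ : B →ₗ[k] A) : A ⊗[k] B →ₗ[k] A :=
  LinearMap.mul' k A ∘ₗ (φ ∘ₗ LinearMap.mul' k B ∘ₗ
      (antipode k ∘ₗ (f : A →ₗ[k] B)).rTensor B).lTensor A ∘ₗ
    (TensorProduct.assoc k A A B).toLinearMap ∘ₗ comul.rTensor B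

lemma averaged_tmul (f : A →ₐc[k] B) (φ : B →ₗ[k] A) (a : A) (b : B) :
    averaged f φ (a ⊗ₜ b) = LinearMap.mul' k A ((φ ∘ₗ LinearMap.mulRight k b ∘ₗ antipode k ∘ₗ
      (f : A →ₗ[k] B)).lTensor A (comul (R := k) a)) := by
  simp only [averaged, LinearMap.comp_apply, LinearMap.rTensor_tmul]
  hopf_tensor_induction comul (R := k) a with x y
  simp

lemma counit_averaged (f : A →ₐc[k] B) (φ : B →ₗ[k] A) (x : A ⊗[k] B) :
    counit (R := k) (averaged f φ x) = counit (R := k) (φ (LinearMap.mul' k B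
      ((antipode k ∘ₗ (f : A →ₗ[k] B)).rTensor B x))) := by
  induction x with
  | zero => simp
  | add x y hx hy => simp only [map_add, hx, hy]
  | tmul a b =>
    rw [averaged_tmul]
    have h : ∀ z : A ⊗[k] A, counit (R := k) (LinearMap.mul' k A ((φ ∘ₗ LinearMap.mulRight k b ∘ₗ
        antipode k ∘ₗ (f : A →ₗ[k] B)).lTensor A z)) = counit (R := k)
        (φ (antipode k (f (TensorProduct.lid k A (counit.rTensor A z))) * b)) := by
      intro z
      induction z with
      | zero => simp
      | add x y hx hy => simp only [map_add, hx, hy, add_mul]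
      | tmul x y => simp
    rw [h]
    simp

/-- If `φ` is colinear then so is `a ⊗ b ↦ a₁ φ(S(f(a₂)) b)`. -/
lemma coact_averaged (f : A →ₐc[k] B) (φ : B →ₗ[k] A)
    (hφ : ∀ b, coact f (φ b) = φ.rTensor B (comul (R := k) b)) (x : A ⊗[k] B) :
    coact f (averaged f φ x) = cofreeLift (averaged f φ) x := by
  induction x with
  | zero => simp
  | add x y hx hy => simp only [map_add, hx, hy]
  | tmul a b =>
    -- `R d = (φ ⊗ id)(Δ(S d) Δ b)` and `Q (c ⊗ d) = (φ ⊗ id)((1 ⊗ c) Δ(S d) Δ b)`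
    let R : B →ₗ[k] A ⊗[k] B := φ.rTensor B ∘ₗ LinearMap.mulRight k (comul (R := k) b) ∘ₗ
      comul ∘ₗ antipode k
    let Q : B ⊗[k] B →ₗ[k] A ⊗[k] B := φ.rTensor B ∘ₗ LinearMap.mulRight k (comul (R := k) b) ∘ₗ
      LinearMap.mul' k (B ⊗[k] B) ∘ₗ TensorProduct.map
        (Algebra.TensorProduct.includeRight : B →ₐ[k] B ⊗[k] B).toLinearMap (comul ∘ₗ antipode k)
    have hQ : ∀ c, Q (comul (R := k) c) =
        φ.rTensor B ((antipode k c ⊗ₜ 1) * comul (R := k) b) := by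
      intro c
      rw [← includeRight_mul_coact_antipode (BialgHom.id k B) c]
      have : (coact (BialgHom.id k B)).toLinearMap = comul := by
        ext c
        simp only [AlgHom.toLinearMap_apply, coact_apply]
        exact LinearMap.congr_fun (LinearMap.lTensor_id B B) _
      rw [this]
      rfl
    have hQR : ∀ c d, Q (c ⊗ₜ d) = (1 ⊗ₜ c) * R d := by
      intro c d
      simp only [Q, R, LinearMap.comp_apply, TensorProduct.map_tmul, LinearMap.mul'_apply,
        LinearMap.mulRight_apply, mul_assoc, AlgHom.toLinearMap_apply,
        Algebra.TensorProduct.includeRight_apply]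
      induction comul (R := k) (antipode k d) * comul (R := k) b with
      | zero => simp
      | add x y hx hy => simp only [mul_add, map_add, hx, hy]
      | tmul x y => simp
    have hlhs : ∀ z : A ⊗[k] A, coact f (LinearMap.mul' k A ((φ ∘ₗ LinearMap.mulRight k b ∘ₗ
        antipode k ∘ₗ (f : A →ₗ[k] B)).lTensor A z)) =
        LinearMap.mul' k (A ⊗[k] B) (TensorProduct.map
          (Algebra.TensorProduct.includeLeft : A →ₐ[k] A ⊗[k] B).toLinearMap
          (Q ∘ₗ TensorProduct.map (f : A →ₗ[k] B) (f : A →ₗ[k] B))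
          (TensorProduct.assoc k A A A (comul.rTensor A z))) := by
      intro z
      induction z with
      | zero => simp
      | add x y hx hy => simp only [map_add, hx, hy]
      | tmul x y =>
        simp only [LinearMap.lTensor_tmul, LinearMap.mul'_apply, map_mul, LinearMap.comp_apply, hφ,
          LinearMap.mulRight_apply, Bialgebra.comul_mul, LinearMap.rTensor_tmul]
        rw [coact_apply]
        hopf_tensor_induction comul (R := k) x with x₁ x₂
        simp [hQR, ← mul_assoc, R]
    rw [averaged_tmul, hlhs, coassoc_apply]
    have hcomul : TensorProduct.map (f : A →ₗ[k] B) (f : A →ₗ[k] B) ∘ₗ comul =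
        comul ∘ₗ (f : A →ₗ[k] B) := by
      ext a; exact CoalgHomClass.map_comp_comul_apply f a
    rw [← LinearMap.comp_apply (TensorProduct.map _ _), LinearMap.map_comp_lTensor,
      LinearMap.comp_assoc, hcomul]
    have hrhs : cofreeLift (averaged f φ) (a ⊗ₜ b) = LinearMap.mul' k (A ⊗[k] B) (TensorProduct.map
          (Algebra.TensorProduct.includeLeft : A →ₐ[k] A ⊗[k] B).toLinearMap
          (φ.rTensor B ∘ₗ LinearMap.mulRight k (comul (R := k) b) ∘ₗ
            (Algebra.TensorProduct.includeLeft : B →ₐ[k] B ⊗[k] B).toLinearMap ∘ₗ antipode k ∘ₗ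
            (f : A →ₗ[k] B)) (comul (R := k) a)) := by
      simp only [cofreeLift, LinearMap.comp_apply, LinearMap.lTensor_tmul]
      induction comul (R := k) b with
      | zero =>
        have : LinearMap.mulRight k (0 : B ⊗[k] B) = 0 := by ext; simp
        rw [this]
        simp
      | add x y hx hy =>
        have : LinearMap.mulRight k (x + y) = LinearMap.mulRight k x + LinearMap.mulRight k y := by
          ext; simp [mul_add]
        rw [this]
        simp only [TensorProduct.tmul_add, map_add, hx, hy, LinearMap.add_comp, LinearMap.comp_add,
          TensorProduct.map_add_right, LinearMap.add_apply]
      | tmul b₁ b₂ =>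
        simp only [LinearEquiv.coe_coe, TensorProduct.assoc_symm_tmul, LinearMap.rTensor_tmul,
          averaged_tmul]
        hopf_tensor_induction comul (R := k) a with x y
        simp
    rw [hrhs]
    congr 2
    ext c
    simp [hQ]

/-- A surjection of cocommutative Hopf algebras over a field has a colinear section. -/
theorem exists_colinear_section [IsCocomm k A] (f : A →ₐc[k] B) (hf : Function.Surjective f) :
    ∃ s : B →ₗ[k] A, (∀ b, f (s b) = b) ∧ ∀ b, coact f (s b) = s.rTensor B (comul (R := k) b) := by
  obtain ⟨g, hg1, hg2⟩ := exists_colinear_retraction f hf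
  -- `φ` is colinear with `φ 1 = 1`; averaging it over a linear section `t` gives
  -- `s(b) = t(b₁)₁ φ(S(f(t(b₁)₂)) b₂)`, which moreover preserves the counit
  let φ : B →ₗ[k] A := g ∘ₗ TensorProduct.mk k A B 1
  have hφ : ∀ b, coact f (φ b) = φ.rTensor B (comul (R := k) b) := by
    intro b
    simp only [φ, LinearMap.comp_apply, hg2, cofreeLift, TensorProduct.mk_apply,
      LinearMap.lTensor_tmul]
    hopf_tensor_induction comul (R := k) b with x y
    simp
  have hφ1 : φ 1 = 1 := by
    have := hg1 1
    rwa [map_one] at this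
  obtain ⟨t, ht⟩ := (f : A →ₗ[k] B).exists_rightInverse_of_surjective (LinearMap.range_eq_top.2 hf)
  let s : B →ₗ[k] A := averaged f φ ∘ₗ t.rTensor B ∘ₗ comul
  have hs : ∀ b, coact f (s b) = s.rTensor B (comul (R := k) b) := by
    intro b
    simp only [s, LinearMap.comp_apply]
    rw [coact_averaged f φ hφ, LinearMap.rTensor_comp_apply, LinearMap.rTensor_comp_apply,
      ← coassoc_symm_apply]
    simp only [cofreeLift, LinearMap.comp_apply]
    congr 1
    hopf_tensor_induction comul (R := k) b with x y
    simp only [LinearMap.rTensor_tmul, LinearMap.lTensor_tmul]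
    hopf_tensor_induction comul (R := k) y with y z
    simp
  have hεs : ∀ b, counit (R := k) (s b) = counit (R := k) b := by
    intro b
    simp only [s, LinearMap.comp_apply]
    rw [counit_averaged, ← LinearMap.rTensor_comp_apply, LinearMap.comp_assoc, ht,
      LinearMap.comp_id, mul_antipode_rTensor_comul_apply, Algebra.algebraMap_eq_smul_one,
      map_smul, hφ1, map_smul, Bialgebra.counit_one, smul_eq_mul, mul_one]
  -- a colinear map preserving the counit is a section: apply the counit to the first factor
  refine ⟨s, fun b => ?_, hs⟩
  have h1 : ∀ a, f a = TensorProduct.lid k B (counit.rTensor B (coact f a)) := by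
    intro a
    have : f a = f (TensorProduct.lid k A (counit.rTensor A (comul (R := k) a))) := by simp
    rw [this, coact_apply]
    induction comul (R := k) a with
    | zero => simp only [map_zero]
    | add x y hx hy => simp only [map_add, hx, hy]
    | tmul x y => simp
  rw [h1, hs, ← LinearMap.rTensor_comp_apply]
  have : (counit : A →ₗ[k] k) ∘ₗ s = counit := LinearMap.ext hεs
  rw [this, rTensor_counit_comul]
  simp

/-- By cocommutativity, the convolution product of `q ⊗ 1` and `1 ⊗ f` is commutative. -/
lemma toConv_includeLeft_mul_includeRight [IsCocomm k A] (f : A →ₐc[k] B) (q : A →ₗ[k] A) :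
    toConv ((Algebra.TensorProduct.includeLeft : A →ₐ[k] A ⊗[k] B).toLinearMap ∘ₗ q) *
    toConv ((Algebra.TensorProduct.includeRight : B →ₐ[k] A ⊗[k] B).comp
      (f : A →ₐ[k] B)).toLinearMap =
    toConv ((Algebra.TensorProduct.includeRight : B →ₐ[k] A ⊗[k] B).comp
      (f : A →ₐ[k] B)).toLinearMap *
    toConv ((Algebra.TensorProduct.includeLeft : A →ₐ[k] A ⊗[k] B).toLinearMap ∘ₗ q) := by
  ext a
  rw [LinearMap.convMul_apply, LinearMap.convMul_apply]
  conv_lhs => rw [← comm_comul k a]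
  hopf_tensor_induction comul (R := k) a with x y
  simp

/-- For a colinear section `s`, the element `S(c₁) s(f(c₂))` lies in the Hopf kernel of `f`. -/
lemma antipode_mul_section_mem_coinv [IsCocomm k A] (f : A →ₐc[k] B) {s : B →ₗ[k] A}
    (hs : ∀ b, coact f (s b) = s.rTensor B (comul (R := k) b)) (c : A) :
    LinearMap.mul' k A (TensorProduct.map (antipode k) (s ∘ₗ (f : A →ₗ[k] B))
      (comul (R := k) c)) ∈ coinv f := by
  let ι : A →ₐ[k] A ⊗[k] B := Algebra.TensorProduct.includeLeft
  let q : A →ₗ[k] A := s ∘ₗ (f : A →ₗ[k] B)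
  let j : WithConv (A →ₗ[k] A ⊗[k] B) := toConv
    ((Algebra.TensorProduct.includeRight : B →ₐ[k] A ⊗[k] B).comp (f : A →ₐ[k] B)).toLinearMap
  -- with `ρ` the coaction and `j(a) = 1 ⊗ f(a)`, in the convolution algebra
  -- `(ρ ∘ S) * j = S ⊗ 1` and `ρ ∘ q = j * (q ⊗ 1)`
  have h1 : toConv ((coact f).toLinearMap ∘ₗ antipode k) * j =
      toConv (ι.toLinearMap ∘ₗ antipode k) := by
    have h2 := toConv_comp_antipode_mul_algHom (coact f)
    have h3 := toConv_includeLeft_mul_includeRight f LinearMap.id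
    rw [LinearMap.comp_id] at h3
    rw [toConv_coact, h3, ← mul_assoc] at h2
    exact left_inv_eq_right_inv h2 (toConv_algHom_mul_comp_antipode ι)
  have h4 : toConv ((coact f).toLinearMap ∘ₗ q) = j * toConv (ι.toLinearMap ∘ₗ q) := by
    rw [← toConv_includeLeft_mul_includeRight]
    ext a
    rw [LinearMap.convMul_apply]
    have h5 : comul (R := k) (f a) =
      TensorProduct.map (f : A →ₗ[k] B) (f : A →ₗ[k] B) (comul (R := k) a) :=
        (CoalgHomClass.map_comp_comul_apply f a).symm
    simp only [q, LinearMap.comp_apply, AlgHom.toLinearMap_apply]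
    erw [hs, h5]
    hopf_tensor_induction comul (R := k) a with x y
    simp
  have h6 := LinearMap.algHom_comp_convMul_distrib (coact f) (toConv (antipode k (A := A)))
    (toConv q)
  have h7 := LinearMap.algHom_comp_convMul_distrib ι (toConv (antipode k (A := A))) (toConv q)
  have h8 : toConv ((coact f).toLinearMap ∘ₗ antipode k) * toConv ((coact f).toLinearMap ∘ₗ q) =
      toConv (ι.toLinearMap ∘ₗ antipode k) * toConv (ι.toLinearMap ∘ₗ q) := by
    rw [h4, ← mul_assoc, h1]
  exact LinearMap.congr_fun (h6.trans ((congrArg ofConv h8).trans h7.symm)) c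

/-- An algebra map that is trivial on the Hopf kernel of `f` factors through `f`, since
`s(f(c)) = c₁ κ(c₂)` with `κ(c) = S(c₁) s(f(c₂))` in the Hopf kernel. -/
lemma apply_section_of_coinv [IsCocomm k A] (f : A →ₐc[k] B) {s : B →ₗ[k] A}
    (hfs : ∀ b, f (s b) = b)
    (hs : ∀ b, coact f (s b) = s.rTensor B (comul (R := k) b)) {C : Type*} [Ring C] [Algebra k C]
    (h : A →ₐ[k] C) (hh : ∀ x ∈ coinv f, h x = algebraMap k C (counit x)) (c : A) :
    h (s (f c)) = h c := by
  let q : A →ₗ[k] A := s ∘ₗ (f : A →ₗ[k] B)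
  let κ : WithConv (A →ₗ[k] A) := toConv (antipode k) * toConv q
  have hε : ∀ a, counit (R := k) (q a) = counit (R := k) a := fun a => by
    rw [← CoalgHomClass.counit_comp_apply f (q a)]
    simp [q, hfs]
  have hκ : h.toLinearMap ∘ₗ κ.ofConv = (1 : WithConv (A →ₗ[k] C)).ofConv := by
    ext a
    have := hh _ (antipode_mul_section_mem_coinv f hs a)
    refine Eq.trans this ?_
    rw [LinearMap.convOne_apply]
    congr 1
    have h2 : counit (R := k) a = counit (R := k) (TensorProduct.lid k A
      (counit.rTensor A (comul (R := k) a))) := by simp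
    rw [h2]
    change counit (R := k) (LinearMap.mul' k A (TensorProduct.map (antipode k) q
      (comul (R := k) a))) = _
    hopf_tensor_induction comul (R := k) a with x y
    simp [hε]
  have h1 : toConv LinearMap.id * κ = toConv q := by
    rw [← mul_assoc, LinearMap.id_mul_antipode, one_mul]
  have h2 := LinearMap.algHom_comp_convMul_distrib h (toConv LinearMap.id) κ
  rw [h1, hκ, toConv_ofConv, mul_one] at h2
  exact LinearMap.congr_fun h2 c

end ColinearSection

/-! ### The second Hopf algebra of a Hopf brace -/

section Circ
variable {k : Type u} {A B : Type v} [Field k] [Ring A] [HopfAlgebra k A] [HopfBrace k A]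
  [Ring B] [HopfAlgebra k B] [HopfBrace k B]

/-- The underlying space of a Hopf brace, as a Hopf algebra for the second multiplication `•`. -/
def Circ (k : Type u) (A : Type v) [Field k] [Ring A] [HopfAlgebra k A] [HopfBrace k A] : Type v :=
  A

instance : AddCommGroup (Circ k A) := inferInstanceAs (AddCommGroup A)
instance : Module k (Circ k A) := inferInstanceAs (Module k A)

instance : Ring (Circ k A) where
  __ := (inferInstance : AddCommGroup (Circ k A))
  mul a b := HopfBrace.bmul (k := k) (H := A) a b
  one := (1 : A)
  mul_assoc := HopfBrace.bmul_assoc (k := k) (H := A)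
  one_mul := HopfBrace.one_bmul (k := k) (H := A)
  mul_one := HopfBrace.bmul_one (k := k) (H := A)
  left_distrib a b c := map_add (HopfBrace.bmul (k := k) (H := A) a) b c
  right_distrib a b c := LinearMap.map_add₂ (HopfBrace.bmul (k := k) (H := A)) a b c
  zero_mul a := LinearMap.map_zero₂ (HopfBrace.bmul (k := k) (H := A)) a
  mul_zero a := map_zero (HopfBrace.bmul (k := k) (H := A) a)

instance : Algebra k (Circ k A) :=
  Algebra.ofModule
    (fun r a b => LinearMap.map_smul₂ (HopfBrace.bmul (k := k) (H := A)) r a b)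
    (fun r a b => map_smul (HopfBrace.bmul (k := k) (H := A) a) r b)

instance : Coalgebra k (Circ k A) := inferInstanceAs (Coalgebra k A)

instance [IsCocomm k A] : IsCocomm k (Circ k A) := inferInstanceAs (IsCocomm k A)

lemma circ_comul_mul (a b : Circ k A) :
    comul (R := k) (a * b) = comul (R := k) a * comul (R := k) b := by
  refine (HopfBrace.comul_bmul (k := k) (H := A) a b).trans ?_
  change TensorProduct.map₂ (LinearMap.mul k (Circ k A)) (LinearMap.mul k (Circ k A))
    (comul (R := k) a) (comul (R := k) b) = _
  generalize comul (R := k) a = s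
  generalize comul (R := k) b = t
  induction s with
  | zero => rw [map_zero, LinearMap.zero_apply, zero_mul]
  | add x y hx hy => rw [map_add, LinearMap.add_apply, hx, hy, add_mul]
  | tmul x y =>
    induction t with
    | zero => simp
    | add z w hz hw => rw [map_add, hz, hw, mul_add]
    | tmul z w => simp

instance : Bialgebra k (Circ k A) :=
  Bialgebra.mk' k (Circ k A) (Bialgebra.counit_one (R := k) (A := A))
    (fun {a b} => HopfBrace.counit_bmul (k := k) (H := A) a b)
    (Bialgebra.comul_one (R := k) (A := A)) (fun {a b} => circ_comul_mul a b)

lemma circ_algebraMap (r : k) : algebraMap k (Circ k A) r = (algebraMap k A r : A) :=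
  (Algebra.algebraMap_eq_smul_one r).trans (Algebra.algebraMap_eq_smul_one (A := A) r).symm

instance : HopfAlgebra k (Circ k A) where
  antipode := HopfBrace.bantipode (k := k) (H := A)
  mul_antipode_rTensor_comul := by
    ext a
    exact (HopfBrace.bantipode_bmul (k := k) (H := A) a).trans (circ_algebraMap _).symm
  mul_antipode_lTensor_comul := by
    ext a
    exact (HopfBrace.bmul_bantipode (k := k) (H := A) a).trans (circ_algebraMap _).symm

/-- A Hopf brace map as a map of Hopf algebras for `•`. -/
def circHom (f : A →ₐc[k] B) (hf : ∀ a b : A, f (HopfBrace.bmul (k := k) a b) =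
    HopfBrace.bmul (k := k) (f a) (f b)) : Circ k A →ₐc[k] Circ k B :=
  BialgHom.ofAlgHom
    { toFun := f
      map_one' := map_one f
      map_mul' := hf
      map_zero' := map_zero f
      map_add' := map_add f
      commutes' := fun r => by
        rw [circ_algebraMap, circ_algebraMap]; exact AlgHomClass.commutes f r }
    (by
      have h : ∀ a : A, _ := CoalgHomClass.counit_comp_apply f
      exact AlgHom.ext fun a => h a)
    (by
      have h : ∀ a : A, _ := CoalgHomClass.map_comp_comul_apply f
      exact AlgHom.ext fun a => h a)

lemma map_bantipode (f : A →ₐc[k] B) (hf : ∀ a b : A, f (HopfBrace.bmul (k := k) a b) =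
    HopfBrace.bmul (k := k) (f a) (f b)) (a : A) :
    f (HopfBrace.bantipode (k := k) a) = HopfBrace.bantipode (k := k) (f a) :=
  map_antipode (circHom f hf) a

end Circ

/-! ### Subspaces stable under functionals -/

section EqualizerSub
open HopfAlgebra
variable {k : Type*} [Field k]

/-- In a cocommutative coalgebra, a subspace stable under all functionals is a subcoalgebra. -/
lemma comul_mem_range_map {C : Type*} [AddCommGroup C] [Module k C] [Coalgebra k C]
    [IsCocomm k C] (S : Submodule k C) (hS : ∀ (μ : Module.Dual k C), ∀ c ∈ S, act μ c ∈ S)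
    {c : C} (hc : c ∈ S) :
    comul (R := k) c ∈ LinearMap.range (TensorProduct.map S.subtype S.subtype) := by
  obtain ⟨p, hp⟩ := S.subtype.exists_leftInverse_of_injective
    (LinearMap.ker_eq_bot.2 S.injective_subtype)
  have h1 : (S.subtype ∘ₗ p).rTensor C (comul (R := k) c) = comul (R := k) c := by
    refine eq_of_slice_eq fun μ => ?_
    rw [slice_rTensor, ← act_apply]
    exact congrArg Subtype.val (LinearMap.congr_fun hp ⟨act μ c, hS μ c hc⟩)
  have h2 : (S.subtype ∘ₗ p).lTensor C (comul (R := k) c) = comul (R := k) c := by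
    have h : ∀ z : C ⊗[k] C, TensorProduct.comm k C C ((S.subtype ∘ₗ p).rTensor C z) =
        (S.subtype ∘ₗ p).lTensor C (TensorProduct.comm k C C z) := by
      intro z
      induction z with
      | zero => simp
      | add x y hx hy => simp only [map_add, hx, hy]
      | tmul x y => simp
    have h3 := h (comul (R := k) c)
    rw [h1, comm_comul] at h3
    exact h3.symm
  refine ⟨TensorProduct.map p p (comul (R := k) c), ?_⟩
  rw [← LinearMap.comp_apply, ← TensorProduct.map_comp]
  conv_rhs => rw [← h1, ← h2, ← LinearMap.comp_apply, LinearMap.rTensor_comp_lTensor]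

variable {A B : Type*} [Ring A] [HopfAlgebra k A] [Ring B] [HopfAlgebra k B]
  [IsCocomm k A]

lemma coact_act_left (f : A →ₐc[k] B) (μ : Module.Dual k A) (a : A) :
    coact f (act μ a) = (act μ).rTensor B (coact f a) := by
  rw [coact_apply, coact_apply, comul_act']
  hopf_tensor_induction comul (R := k) a with x y
  simp

lemma coact_antipode (f : A →ₐc[k] B) (a : A) :
    coact f (antipode k a) = TensorProduct.map (antipode k) (antipode k) (coact f a) := by
  rw [coact_apply, coact_apply, comul_antipode]
  hopf_tensor_induction comul (R := k) a with x y
  simp [map_antipode]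

end EqualizerSub

end HopfColinear

open HopfColinear

/-! ### Sub-Hopf-braces -/

/-- A sub-Hopf-brace: a subalgebra for `·` closed under `•`, both antipodes and `Δ`. The condition
on `Δ` is that `Δ(a)` lies in the image of the tensor square of the subalgebra. -/
structure SubHopfBrace {k : Type u} [Field k] (A : HBRcoc.{v} k) extends Subalgebra k A where
  comul_mem : ∀ a ∈ toSubalgebra, comul (R := k) a ∈ LinearMap.range
    (TensorProduct.map toSubalgebra.val.toLinearMap toSubalgebra.val.toLinearMap)
  antipode_mem : ∀ a ∈ toSubalgebra, HopfAlgebra.antipode k a ∈ toSubalgebra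
  bmul_mem : ∀ a ∈ toSubalgebra, ∀ b ∈ toSubalgebra,
    HopfBrace.bmul (k := k) a b ∈ toSubalgebra
  bantipode_mem : ∀ a ∈ toSubalgebra, HopfBrace.bantipode (k := k) a ∈ toSubalgebra

namespace SubHopfBrace
variable {k : Type u} [Field k] {A : HBRcoc.{v} k} (S : SubHopfBrace A)

/-- The underlying type of a sub-Hopf-brace. -/
def Carrier : Type v := S.toSubalgebra

instance : Ring S.Carrier := inferInstanceAs (Ring S.toSubalgebra)
instance : Algebra k S.Carrier := inferInstanceAs (Algebra k S.toSubalgebra)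

/-- The inclusion of a sub-Hopf-brace. -/
def incl : S.Carrier →ₐ[k] A := S.toSubalgebra.val

lemma incl_injective : Function.Injective S.incl := Subtype.val_injective

lemma incl_mem (a : S.Carrier) : S.incl a ∈ S.toSubalgebra := a.2

lemma exists_incl {a : A} (ha : a ∈ S.toSubalgebra) : ∃ b, S.incl b = a := ⟨⟨a, ha⟩, rfl⟩

lemma map_incl_injective : Function.Injective
    (TensorProduct.map S.incl.toLinearMap S.incl.toLinearMap) :=
  TensorProduct.map_injective_of_flat_flat _ _ S.incl_injective S.incl_injective

lemma map_map_incl_injective : Function.Injective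
    (TensorProduct.map S.incl.toLinearMap
      (TensorProduct.map S.incl.toLinearMap S.incl.toLinearMap)) :=
  TensorProduct.map_injective_of_flat_flat _ _ S.incl_injective S.map_incl_injective

/-- The linear map into `S` through which a linear map with values in `S` factors. -/
def restrict {V : Type*} [AddCommGroup V] [Module k V] (g : V →ₗ[k] A)
    (hg : ∀ x, g x ∈ S.toSubalgebra) : V →ₗ[k] S.Carrier :=
  g.codRestrict (Subalgebra.toSubmodule S.toSubalgebra) hg

@[simp] lemma incl_restrict {V : Type*} [AddCommGroup V] [Module k V] (g : V →ₗ[k] A)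
    (hg : ∀ x, g x ∈ S.toSubalgebra) (x : V) : S.incl (S.restrict g hg x) = g x := rfl

instance : CoalgebraStruct k S.Carrier where
  comul := (LinearEquiv.ofInjective _ S.map_incl_injective).symm.toLinearMap ∘ₗ
    (comul ∘ₗ S.incl.toLinearMap).codRestrict _ (fun a => S.comul_mem _ (S.incl_mem a))
  counit := counit ∘ₗ S.incl.toLinearMap

lemma counit_incl (a : S.Carrier) : counit (R := k) (S.incl a) = counit (R := k) a := rfl

lemma map_comul (a : S.Carrier) :
    TensorProduct.map S.incl.toLinearMap S.incl.toLinearMap (comul (R := k) a) =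
      comul (R := k) (S.incl a) :=
  LinearEquiv.ofInjective_symm_apply (h := S.map_incl_injective)
    (x := (comul ∘ₗ S.incl.toLinearMap).codRestrict _ (fun a => S.comul_mem _ (S.incl_mem a)) a)

lemma map_map_lTensor_comul (z : S.Carrier ⊗[k] S.Carrier) :
    TensorProduct.map S.incl.toLinearMap
      (TensorProduct.map S.incl.toLinearMap S.incl.toLinearMap) (comul.lTensor _ z) =
    comul.lTensor A (TensorProduct.map S.incl.toLinearMap S.incl.toLinearMap z) := by
  induction z with
  | zero => simp
  | add x y hx hy => simp only [map_add, hx, hy]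
  | tmul x y => simp [map_comul]

lemma map_map_assoc_rTensor_comul (z : S.Carrier ⊗[k] S.Carrier) :
    TensorProduct.map S.incl.toLinearMap
      (TensorProduct.map S.incl.toLinearMap S.incl.toLinearMap)
        (TensorProduct.assoc k _ _ _ (comul.rTensor _ z)) =
    TensorProduct.assoc k A A A (comul.rTensor A
      (TensorProduct.map S.incl.toLinearMap S.incl.toLinearMap z)) := by
  induction z with
  | zero => simp
  | add x y hx hy => simp only [map_add, hx, hy]
  | tmul x y =>
    simp only [LinearMap.rTensor_tmul, TensorProduct.map_tmul, AlgHom.toLinearMap_apply,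
      ← map_comul]
    generalize comul (R := k) x = w
    induction w with
    | zero => simp
    | add x y hx hy => simp only [map_add, TensorProduct.add_tmul, hx, hy]
    | tmul z w => simp

instance : Coalgebra k S.Carrier where
  coassoc := by
    ext a
    apply S.map_map_incl_injective
    simp only [LinearMap.comp_apply, LinearEquiv.coe_coe]
    rw [map_map_assoc_rTensor_comul, map_map_lTensor_comul, map_comul, coassoc_apply]
  rTensor_counit_comp_comul := by
    ext a
    have h : ∀ z : S.Carrier ⊗[k] S.Carrier, S.incl.toLinearMap.lTensor k (counit.rTensor _ z) =
        counit.rTensor A (TensorProduct.map S.incl.toLinearMap S.incl.toLinearMap z) := by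
      intro z
      induction z with
      | zero => simp
      | add x y hx hy => simp only [map_add, hx, hy]
      | tmul x y => simp [counit_incl]
    apply Module.Flat.lTensor_preserves_injective_linearMap (M := k) S.incl.toLinearMap
      S.incl_injective
    rw [LinearMap.comp_apply, h, map_comul, rTensor_counit_comul]
    simp
  lTensor_counit_comp_comul := by
    ext a
    have h : ∀ z : S.Carrier ⊗[k] S.Carrier, S.incl.toLinearMap.rTensor k (counit.lTensor _ z) =
        counit.lTensor A (TensorProduct.map S.incl.toLinearMap S.incl.toLinearMap z) := by
      intro z
      induction z with
      | zero => simp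
      | add x y hx hy => simp only [map_add, hx, hy]
      | tmul x y => simp [counit_incl]
    apply Module.Flat.rTensor_preserves_injective_linearMap (M := k) S.incl.toLinearMap
      S.incl_injective
    rw [LinearMap.comp_apply, h, map_comul, lTensor_counit_comul]
    simp

instance : IsCocomm k S.Carrier where
  comm_comp_comul := by
    ext a
    apply S.map_incl_injective
    have h : ∀ z : S.Carrier ⊗[k] S.Carrier,
        TensorProduct.map S.incl.toLinearMap S.incl.toLinearMap
          (TensorProduct.comm k _ _ z) = TensorProduct.comm k A A
          (TensorProduct.map S.incl.toLinearMap S.incl.toLinearMap z) := by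
      intro z
      induction z with
      | zero => simp
      | add x y hx hy => simp only [map_add, hx, hy]
      | tmul x y => simp
    simp only [LinearMap.comp_apply, LinearEquiv.coe_coe]
    rw [h, map_comul, comm_comul]

instance : Bialgebra k S.Carrier :=
  Bialgebra.mk' k S.Carrier
    (by rw [← counit_incl, map_one, Bialgebra.counit_one])
    (fun {a b} => by simp only [← counit_incl, map_mul, Bialgebra.counit_mul])
    (by
      apply S.map_incl_injective
      rw [map_comul, map_one, Bialgebra.comul_one, Algebra.TensorProduct.one_def,
        Algebra.TensorProduct.one_def]
      simp)
    (fun {a b} => by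
      apply S.map_incl_injective
      have h : ∀ z w : S.Carrier ⊗[k] S.Carrier,
          TensorProduct.map S.incl.toLinearMap S.incl.toLinearMap (z * w) =
          TensorProduct.map S.incl.toLinearMap S.incl.toLinearMap z *
          TensorProduct.map S.incl.toLinearMap S.incl.toLinearMap w :=
        fun z w => map_mul (Algebra.TensorProduct.map S.incl S.incl) z w
      rw [h, map_comul, map_comul, map_comul, map_mul, Bialgebra.comul_mul])

instance : HopfAlgebra k S.Carrier where
  antipode := S.restrict (HopfAlgebra.antipode k ∘ₗ S.incl.toLinearMap)
    (fun a => S.antipode_mem _ (S.incl_mem a))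
  mul_antipode_rTensor_comul := by
    ext a
    apply S.incl_injective
    have h := HopfAlgebra.mul_antipode_rTensor_comul_apply (R := k) (S.incl a)
    rw [← map_comul, counit_incl] at h
    refine Eq.trans ?_ (h.trans (AlgHomClass.commutes S.incl _).symm)
    simp only [LinearMap.comp_apply]
    induction comul (R := k) a with
    | zero => simp only [map_zero]
    | add x y hx hy => simp only [map_add, hx, hy]
    | tmul x y => simp
  mul_antipode_lTensor_comul := by
    ext a
    apply S.incl_injective
    have h := HopfAlgebra.mul_antipode_lTensor_comul_apply (R := k) (S.incl a)
    rw [← map_comul, counit_incl] at h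
    refine Eq.trans ?_ (h.trans (AlgHomClass.commutes S.incl _).symm)
    simp only [LinearMap.comp_apply]
    induction comul (R := k) a with
    | zero => simp only [map_zero]
    | add x y hx hy => simp only [map_add, hx, hy]
    | tmul x y => simp

lemma incl_antipode (a : S.Carrier) :
    S.incl (HopfAlgebra.antipode k a) = HopfAlgebra.antipode k (S.incl a) := rfl

/-- The second multiplication of a sub-Hopf-brace. -/
def bmulAux : S.Carrier →ₗ[k] S.Carrier →ₗ[k] S.Carrier :=
  LinearMap.mk₂ k
    (fun a b => S.restrict (HopfBrace.bmul (k := k) (S.incl a) ∘ₗ S.incl.toLinearMap)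
      (fun b => S.bmul_mem _ (S.incl_mem a) _ (S.incl_mem b)) b)
    (fun a b c => by apply S.incl_injective; simp)
    (fun r a b => by apply S.incl_injective; simp)
    (fun a b c => by apply S.incl_injective; simp)
    (fun r a b => by apply S.incl_injective; simp)

lemma incl_bmulAux (a b : S.Carrier) :
    S.incl (S.bmulAux a b) = HopfBrace.bmul (k := k) (S.incl a) (S.incl b) := rfl

instance : HopfBrace k S.Carrier where
  bmul := S.bmulAux
  bantipode := S.restrict (HopfBrace.bantipode ∘ₗ S.incl.toLinearMap)
    (fun a => S.bantipode_mem _ (S.incl_mem a))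
  bmul_assoc a b c := by
    apply S.incl_injective
    simp only [incl_bmulAux, HopfBrace.bmul_assoc]
  one_bmul a := by
    apply S.incl_injective
    rw [incl_bmulAux, map_one, HopfBrace.one_bmul]
  bmul_one a := by
    apply S.incl_injective
    rw [incl_bmulAux, map_one, HopfBrace.bmul_one]
  counit_bmul a b := by
    simp only [← counit_incl, incl_bmulAux, HopfBrace.counit_bmul]
  comul_bmul a b := by
    apply S.map_incl_injective
    rw [map_comul, incl_bmulAux, HopfBrace.comul_bmul, ← map_comul, ← map_comul]
    generalize comul (R := k) a = s
    generalize comul (R := k) b = t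
    induction s with
    | zero => simp only [map_zero, LinearMap.zero_apply]
    | add x y hx hy => simp only [map_add, LinearMap.add_apply, hx, hy]
    | tmul x y =>
      induction t with
      | zero => simp only [map_zero]
      | add z w hz hw => simp only [map_add, hz, hw]
      | tmul z w => simp [incl_bmulAux]
  bantipode_bmul a := by
    apply S.incl_injective
    have h := HopfBrace.bantipode_bmul (k := k) (S.incl a)
    rw [← map_comul, counit_incl] at h
    refine Eq.trans ?_ (h.trans (AlgHomClass.commutes S.incl _).symm)
    induction comul (R := k) a with
    | zero => simp only [map_zero]
    | add x y hx hy => simp only [map_add, hx, hy]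
    | tmul x y => simp [incl_bmulAux]
  bmul_bantipode a := by
    apply S.incl_injective
    have h := HopfBrace.bmul_bantipode (k := k) (S.incl a)
    rw [← map_comul, counit_incl] at h
    refine Eq.trans ?_ (h.trans (AlgHomClass.commutes S.incl _).symm)
    induction comul (R := k) a with
    | zero => simp only [map_zero]
    | add x y hx hy => simp only [map_add, hx, hy]
    | tmul x y => simp [incl_bmulAux]
  bmul_mul a b c := by
    apply S.incl_injective
    have h := HopfBrace.bmul_mul (k := k) (S.incl a) (S.incl b) (S.incl c)
    rw [← map_comul, ← map_map_lTensor_comul] at h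
    rw [incl_bmulAux, map_mul, h]
    generalize (comul (R := k)).lTensor S.Carrier (comul (R := k) a) = z
    induction z with
    | zero => simp only [map_zero]
    | add x y hx hy => simp only [map_add, hx, hy]
    | tmul x y =>
      induction y with
      | zero => simp only [map_zero, TensorProduct.tmul_zero]
      | add x y hx hy => simp only [map_add, TensorProduct.tmul_add, hx, hy]
      | tmul y z => simp [incl_bmulAux, incl_antipode]

/-- A sub-Hopf-brace as an object. -/
def obj : HBRcoc.{v} k := { carrier := S.Carrier }

/-- The inclusion morphism of a sub-Hopf-brace. -/
def ι : S.obj ⟶ A where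
  hom := BialgHom.ofAlgHom S.incl (by ext; rfl) (by ext a; exact S.map_comul a)
  map_bmul _ _ := rfl

lemma ι_injective : Function.Injective S.ι.hom := S.incl_injective

lemma exists_ι {a : A} (ha : a ∈ S.toSubalgebra) : ∃ b, S.ι.hom b = a := S.exists_incl ha

lemma ι_mem (a : S.obj) : S.ι.hom a ∈ S.toSubalgebra := S.incl_mem a

end SubHopfBrace

/-! ### Morphisms, images and equalizers -/

namespace HBRcoc
variable {k : Type u} [Field k]

section Basic
variable {A B C : HBRcoc.{v} k}

lemma hom_ext {f g : A ⟶ B} (h : ∀ a, f.hom a = g.hom a) : f = g :=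
  Hom.ext (BialgHom.ext h)

@[simp] lemma comp_hom_apply (f : A ⟶ B) (g : B ⟶ C) (a : A) :
    (f ≫ g).hom a = g.hom (f.hom a) := rfl

@[simp] lemma id_hom_apply (a : A) : (𝟙 A : A ⟶ A).hom a = a := rfl

/-- A morphism whose image is contained in that of an injective morphism factors through it. -/
lemma exists_lift_of_injective (i : A ⟶ B) (hi : Function.Injective i.hom) (f : C ⟶ B)
    (h : ∀ c, ∃ a, i.hom a = f.hom c) : ∃ l : C ⟶ A, l ≫ i = f := by
  choose l hl using h
  have hinj : Function.Injective (TensorProduct.map (i.hom : A →ₗ[k] B) (i.hom : A →ₗ[k] B)) :=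
    TensorProduct.map_injective_of_flat_flat _ _ hi hi
  let L : C →ₐ[k] A :=
    { toFun := l
      map_one' := hi (by rw [hl, map_one, map_one])
      map_mul' := fun x y => hi (by rw [hl, map_mul, map_mul, hl, hl])
      map_zero' := hi (by rw [hl, map_zero, map_zero])
      map_add' := fun x y => hi (by rw [hl, map_add, map_add, hl, hl])
      commutes' := fun r => hi (by
        rw [hl, AlgHomClass.commutes, AlgHomClass.commutes]) }
  refine ⟨⟨BialgHom.ofAlgHom L ?_ ?_, fun x y => hi ?_⟩, hom_ext hl⟩
  · ext c
    change counit (R := k) (l c) = counit (R := k) c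
    rw [← CoalgHomClass.counit_comp_apply i.hom, hl, CoalgHomClass.counit_comp_apply]
  · ext c
    apply hinj
    have h1 := CoalgHomClass.map_comp_comul_apply i.hom (l c)
    have h2 := CoalgHomClass.map_comp_comul_apply f.hom c
    rw [hl] at h1
    refine Eq.trans ?_ (h2.trans h1.symm)
    simp only [AlgHom.comp_apply, Bialgebra.comulAlgHom_apply]
    induction comul (R := k) c with
    | zero => simp only [map_zero]
    | add x y hx hy => simp only [map_add, hx, hy]
    | tmul x y =>
      change i.hom (l x) ⊗ₜ i.hom (l y) = f.hom x ⊗ₜ f.hom y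
      rw [hl, hl]
  · change i.hom (l _) = i.hom (HopfBrace.bmul (k := k) (l x) (l y))
    rw [hl, f.map_bmul, i.map_bmul, hl, hl]

/-- A morphism that is constant on the fibres of a surjective morphism factors through it. -/
lemma exists_desc_of_surjective (p : A ⟶ B) (hp : Function.Surjective p.hom) (f : A ⟶ C)
    (l : B → C) (hl : ∀ a, l (p.hom a) = f.hom a) : ∃ g : B ⟶ C, p ≫ g = f := by
  let L : B →ₐ[k] C :=
    { toFun := l
      map_one' := by rw [← map_one p.hom, hl, map_one]
      map_mul' := fun x y => by
        obtain ⟨x, rfl⟩ := hp x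
        obtain ⟨y, rfl⟩ := hp y
        rw [← map_mul, hl, hl, hl, map_mul]
      map_zero' := by rw [← map_zero p.hom, hl, map_zero]
      map_add' := fun x y => by
        obtain ⟨x, rfl⟩ := hp x
        obtain ⟨y, rfl⟩ := hp y
        rw [← map_add, hl, hl, hl, map_add]
      commutes' := fun r => by rw [← AlgHomClass.commutes p.hom, hl, AlgHomClass.commutes] }
  refine ⟨⟨BialgHom.ofAlgHom L ?_ ?_, fun x y => ?_⟩, hom_ext hl⟩
  · ext b
    obtain ⟨a, rfl⟩ := hp b
    change counit (R := k) (l (p.hom a)) = counit (R := k) (p.hom a)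
    rw [hl, CoalgHomClass.counit_comp_apply, CoalgHomClass.counit_comp_apply]
  · ext b
    obtain ⟨a, rfl⟩ := hp b
    have h1 := CoalgHomClass.map_comp_comul_apply p.hom a
    have h2 := CoalgHomClass.map_comp_comul_apply f.hom a
    have h3 : (Bialgebra.comulAlgHom k C).comp L (p.hom a) = comul (R := k) (f.hom a) :=
      congrArg (comul (R := k)) (hl a)
    rw [h3, ← h2]
    simp only [AlgHom.comp_apply, Bialgebra.comulAlgHom_apply]
    rw [← h1]
    clear h1 h2 h3
    induction comul (R := k) a with
    | zero => simp only [map_zero]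
    | add x y hx hy => simp only [map_add, hx, hy]
    | tmul x y =>
      change l (p.hom x) ⊗ₜ l (p.hom y) = f.hom x ⊗ₜ f.hom y
      rw [hl, hl]
  · obtain ⟨x, rfl⟩ := hp x
    obtain ⟨y, rfl⟩ := hp y
    change l _ = HopfBrace.bmul (k := k) (l _) (l _)
    rw [← p.map_bmul, hl, hl, hl, f.map_bmul]

/-- The set-theoretic image of a morphism, as a sub-Hopf-brace. -/
def image (f : A ⟶ B) : SubHopfBrace B where
  toSubalgebra := (f.hom : A →ₐ[k] B).range
  comul_mem := by
    rintro _ ⟨a, rfl⟩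
    have h := CoalgHomClass.map_comp_comul_apply f.hom a
    refine ⟨TensorProduct.map (f.hom : A →ₐ[k] B).rangeRestrict.toLinearMap
      (f.hom : A →ₐ[k] B).rangeRestrict.toLinearMap (comul (R := k) a), ?_⟩
    refine Eq.trans ?_ h
    rw [← LinearMap.comp_apply, ← TensorProduct.map_comp]
    rfl
  antipode_mem := by
    rintro _ ⟨a, rfl⟩
    exact ⟨HopfAlgebra.antipode k a, map_antipode f.hom a⟩
  bmul_mem := by
    rintro _ ⟨a, rfl⟩ _ ⟨b, rfl⟩
    exact ⟨HopfBrace.bmul (k := k) a b, f.map_bmul a b⟩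
  bantipode_mem := by
    rintro _ ⟨a, rfl⟩
    exact ⟨HopfBrace.bantipode (k := k) a, map_bantipode f.hom f.map_bmul a⟩

lemma mem_image (f : A ⟶ B) {b : B} : b ∈ (image f).toSubalgebra ↔ ∃ a, f.hom a = b := Iff.rfl

/-- A morphism as a morphism of Hopf algebras for `•`. -/
def circ (f : A ⟶ B) : Circ k A →ₐc[k] Circ k B := circHom f.hom f.map_bmul

/-- The equalizer of two morphisms: the elements with `a₁ ⊗ f(a₂) = a₁ ⊗ g(a₂)`. -/
def eqSub (f g : A ⟶ B) : SubHopfBrace A where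
  toSubalgebra := AlgHom.equalizer (coact f.hom) (coact g.hom)
  comul_mem a ha := comul_mem_range_map
    (Subalgebra.toSubmodule (AlgHom.equalizer (coact f.hom) (coact g.hom)))
    (fun μ c (hc : coact f.hom c = coact g.hom c) => by
      change coact f.hom _ = coact g.hom _
      rw [coact_act_left, coact_act_left, hc]) ha
  antipode_mem a ha := by
    change coact f.hom _ = coact g.hom _
    rw [coact_antipode, coact_antipode, (ha : coact f.hom a = coact g.hom a)]
  bmul_mem a ha b hb := by
    exact (AlgHom.equalizer (coact (circ f)) (coact (circ g))).mul_mem ha hb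
  bantipode_mem a ha := by
    have h1 := coact_antipode (circ f) a
    have h2 := coact_antipode (circ g) a
    have h3 : coact (circ f) (a : Circ k A) = coact (circ g) (a : Circ k A) := ha
    exact h1.trans ((congrArg _ h3).trans h2.symm)

lemma mem_eqSub {f g : A ⟶ B} {a : A} :
    a ∈ (eqSub f g).toSubalgebra ↔ coact f.hom a = coact g.hom a := Iff.rfl

lemma apply_eq_of_mem_eqSub {f g : A ⟶ B} {a : A} (ha : a ∈ (eqSub f g).toSubalgebra) :
    f.hom a = g.hom a := by
  have h : ∀ (f : A ⟶ B) (a : A), f.hom a =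
      TensorProduct.lid k B (counit.rTensor B (coact f.hom a)) := by
    intro f a
    have : f.hom a = f.hom (TensorProduct.lid k A (counit.rTensor A (comul (R := k) a))) := by simp
    rw [this, coact_apply]
    induction comul (R := k) a with
    | zero => simp only [map_zero]
    | add x y hx hy => simp only [map_add, hx, hy]
    | tmul x y => simp
  rw [h f, h g, mem_eqSub.1 ha]

lemma ι_eqSub_condition (f g : A ⟶ B) : (eqSub f g).ι ≫ f = (eqSub f g).ι ≫ g :=
  hom_ext fun a => (apply_eq_of_mem_eqSub (f := f) (g := g) ((eqSub f g).ι_mem a) :)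

lemma coact_comp (i : C ⟶ A) (f : A ⟶ B) (c : C) :
    coact f.hom (i.hom c) =
      (i.hom : C →ₗ[k] A).rTensor B (coact (i ≫ f).hom c) := by
  rw [coact_apply, coact_apply]
  erw [← CoalgHomClass.map_comp_comul_apply i.hom]
  induction comul (R := k) c with
  | zero => simp only [map_zero]
  | add x y hx hy => simp only [map_add, hx, hy]
  | tmul x y => rfl

lemma exists_lift_eqSub {f g : A ⟶ B} (h : C ⟶ A) (w : h ≫ f = h ≫ g) :
    ∃ l : C ⟶ (eqSub f g).obj, l ≫ (eqSub f g).ι = h :=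
  exists_lift_of_injective _ (eqSub f g).ι_injective h fun c =>
    (eqSub f g).exists_ι (mem_eqSub.2 (by rw [coact_comp, coact_comp, w]))

lemma mem_eqSub_zero {f : A ⟶ B} {a : A} :
    a ∈ (eqSub f 0).toSubalgebra ↔ a ∈ coinv f.hom := by
  have : coact (0 : A ⟶ B).hom a = a ⊗ₜ 1 := by
    have h : a = TensorProduct.rid k A (counit.lTensor A (comul (R := k) a)) := by simp
    conv_rhs => rw [h]
    rw [coact_apply]
    induction comul (R := k) a with
    | zero => simp only [map_zero, TensorProduct.zero_tmul]
    | add x y hx hy => simp only [map_add, TensorProduct.add_tmul, hx, hy]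
    | tmul x y =>
      change x ⊗ₜ algebraMap k B (counit (R := k) y) = _
      simp [Algebra.algebraMap_eq_smul_one, TensorProduct.smul_tmul]
  rw [mem_eqSub, mem_coinv, this]

end Basic

/-! ### Products -/

section Product
open HopfAlgebra
variable (A B : HBRcoc.{v} k)

variable (k) in
/-- The shuffle `(a₁ ⊗ a₂ ⊗ a₃) ⊗ (b₁ ⊗ b₂ ⊗ b₃) ↦ (a₁ ⊗ b₁) ⊗ (a₂ ⊗ b₂) ⊗ (a₃ ⊗ b₃)`. -/
def tripleShuffle (V W : Type*) [AddCommGroup V] [Module k V] [AddCommGroup W] [Module k W] :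
    (V ⊗[k] (V ⊗[k] V)) ⊗[k] (W ⊗[k] (W ⊗[k] W)) →ₗ[k]
      (V ⊗[k] W) ⊗[k] ((V ⊗[k] W) ⊗[k] (V ⊗[k] W)) :=
  (TensorProduct.tensorTensorTensorComm k V V W W).toLinearMap.lTensor (V ⊗[k] W) ∘ₗ
    (TensorProduct.tensorTensorTensorComm k V (V ⊗[k] V) W (W ⊗[k] W)).toLinearMap

lemma tripleShuffle_tmul {V W : Type*} [AddCommGroup V] [Module k V] [AddCommGroup W] [Module k W]
    (a₁ : V) (s : V ⊗[k] V) (b₁ : W) (t : W ⊗[k] W) :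
    tripleShuffle k V W ((a₁ ⊗ₜ s) ⊗ₜ (b₁ ⊗ₜ t)) =
      (a₁ ⊗ₜ b₁) ⊗ₜ TensorProduct.tensorTensorTensorComm k V V W W (s ⊗ₜ t) := rfl

lemma lTensor_comul_comul_tmul (a : A) (b : B) :
    (comul (R := k)).lTensor (A ⊗[k] B) (comul (R := k) (a ⊗ₜ[k] b)) =
      tripleShuffle k A B (comul.lTensor A (comul (R := k) a) ⊗ₜ
        comul.lTensor B (comul (R := k) b)) := by
  rw [TensorProduct.comul_tmul]
  induction comul (R := k) a with
  | zero => simp only [map_zero, TensorProduct.zero_tmul]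
  | add x y hx hy => simp only [map_add, TensorProduct.add_tmul, hx, hy]
  | tmul a₁ a₂ =>
  induction comul (R := k) b with
  | zero => simp only [map_zero, TensorProduct.tmul_zero]
  | add x y hx hy => simp only [map_add, TensorProduct.tmul_add, hx, hy]
  | tmul b₁ b₂ =>
  rw [TensorProduct.AlgebraTensorModule.tensorTensorTensorComm_tmul, LinearMap.lTensor_tmul,
    LinearMap.lTensor_tmul, LinearMap.lTensor_tmul, TensorProduct.comul_tmul, tripleShuffle_tmul]
  rfl

/-- The expression `(a₁ • b) · (S(a₂) · (a₃ • c))` as a linear map of `a₁ ⊗ (a₂ ⊗ a₃)`. -/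
def braceMap {H : Type*} [Ring H] [HopfAlgebra k H] (m : H →ₗ[k] H →ₗ[k] H) (b c : H) :
    H ⊗[k] (H ⊗[k] H) →ₗ[k] H :=
  LinearMap.mul' k H ∘ₗ TensorProduct.map (m.flip b)
    (LinearMap.mul' k H ∘ₗ TensorProduct.map (antipode k) (m.flip c))

lemma braceMap_tmul_tmul (a c : A) (b d : B) (s : A ⊗[k] (A ⊗[k] A)) (t : B ⊗[k] (B ⊗[k] B)) :
    braceMap (TensorProduct.map₂ (HopfBrace.bmul (k := k)) (HopfBrace.bmul (k := k)))
      (a ⊗ₜ[k] b) (c ⊗ₜ[k] d)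
      (tripleShuffle k A B (s ⊗ₜ t)) =
    braceMap (HopfBrace.bmul (k := k)) a c s ⊗ₜ braceMap (HopfBrace.bmul (k := k)) b d t := by
  induction s with
  | zero => simp only [map_zero, TensorProduct.zero_tmul]
  | add x y hx hy => simp only [map_add, TensorProduct.add_tmul, hx, hy]
  | tmul a₁ s =>
  induction s with
  | zero => simp only [map_zero, TensorProduct.zero_tmul, TensorProduct.tmul_zero]
  | add x y hx hy => simp only [map_add, TensorProduct.add_tmul, TensorProduct.tmul_add, hx, hy]
  | tmul a₂ a₃ =>
  induction t with
  | zero => simp only [map_zero, TensorProduct.tmul_zero]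
  | add x y hx hy => simp only [map_add, TensorProduct.tmul_add, hx, hy]
  | tmul b₁ t =>
  induction t with
  | zero => simp only [map_zero, TensorProduct.tmul_zero]
  | add x y hx hy => simp only [map_add, TensorProduct.tmul_add, hx, hy]
  | tmul b₂ b₃ => simp [braceMap, tripleShuffle_tmul]

lemma tensor_bmul_mul_tmul (a c e : A) (b d f : B) :
    TensorProduct.map₂ (HopfBrace.bmul (k := k)) (HopfBrace.bmul (k := k)) (a ⊗ₜ[k] b)
      ((c ⊗ₜ[k] d) * (e ⊗ₜ[k] f)) =
    braceMap (TensorProduct.map₂ (HopfBrace.bmul (k := k)) (HopfBrace.bmul (k := k)))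
      (c ⊗ₜ[k] d) (e ⊗ₜ[k] f)
      ((comul (R := k)).lTensor (A ⊗[k] B) (comul (R := k) (a ⊗ₜ[k] b))) := by
  rw [lTensor_comul_comul_tmul, braceMap_tmul_tmul, Algebra.TensorProduct.tmul_mul_tmul,
    TensorProduct.map₂_apply_tmul, TensorProduct.map_tmul, HopfBrace.bmul_mul, HopfBrace.bmul_mul]
  rfl

instance tensorHopfBrace : HopfBrace k (A ⊗[k] B) where
  bmul := TensorProduct.map₂ HopfBrace.bmul HopfBrace.bmul
  bantipode := TensorProduct.map HopfBrace.bantipode HopfBrace.bantipode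
  bmul_assoc x y z := by
    induction x with
    | zero => simp
    | add x y hx hy => simp only [map_add, LinearMap.add_apply, hx, hy]
    | tmul a b =>
    induction y with
    | zero => simp
    | add x y hx hy => simp only [map_add, LinearMap.add_apply, hx, hy]
    | tmul c d =>
    induction z with
    | zero => simp
    | add x y hx hy => simp only [map_add, hx, hy]
    | tmul e f => simp [HopfBrace.bmul_assoc]
  one_bmul x := by
    induction x with
    | zero => simp
    | add x y hx hy => simp only [map_add, hx, hy]
    | tmul a b => simp [Algebra.TensorProduct.one_def, HopfBrace.one_bmul]
  bmul_one x := by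
    induction x with
    | zero => simp
    | add x y hx hy => simp only [map_add, LinearMap.add_apply, hx, hy]
    | tmul a b => simp [Algebra.TensorProduct.one_def, HopfBrace.bmul_one]
  counit_bmul x y := by
    induction x with
    | zero => simp
    | add x y hx hy => simp only [map_add, LinearMap.add_apply, hx, hy, add_mul]
    | tmul a b =>
    induction y with
    | zero => simp
    | add x y hx hy => simp only [map_add, hx, hy, mul_add]
    | tmul c d => simp [HopfBrace.counit_bmul]; ring
  comul_bmul x y := by
    induction x with
    | zero => simp
    | add x y hx hy => simp only [map_add, LinearMap.add_apply, hx, hy]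
    | tmul a b =>
    induction y with
    | zero => simp
    | add x y hx hy => simp only [map_add, hx, hy]
    | tmul c d =>
    rw [TensorProduct.map₂_apply_tmul, TensorProduct.map_tmul, TensorProduct.comul_tmul,
      TensorProduct.comul_tmul, TensorProduct.comul_tmul, HopfBrace.comul_bmul, HopfBrace.comul_bmul]
    induction comul (R := k) a with
    | zero => simp only [map_zero, LinearMap.zero_apply, TensorProduct.zero_tmul]
    | add x y hx hy => simp only [map_add, LinearMap.add_apply, TensorProduct.add_tmul, hx, hy]
    | tmul a₁ a₂ =>
    induction comul (R := k) c with
    | zero => simp only [map_zero, TensorProduct.zero_tmul]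
    | add x y hx hy => simp only [map_add, TensorProduct.add_tmul, hx, hy]
    | tmul c₁ c₂ =>
    induction comul (R := k) b with
    | zero => simp only [map_zero, LinearMap.zero_apply, TensorProduct.tmul_zero]
    | add x y hx hy => simp only [map_add, LinearMap.add_apply, TensorProduct.tmul_add, hx, hy]
    | tmul b₁ b₂ =>
    induction comul (R := k) d with
    | zero => simp only [map_zero, TensorProduct.tmul_zero]
    | add x y hx hy => simp only [map_add, TensorProduct.tmul_add, hx, hy]
    | tmul d₁ d₂ => simp
  bantipode_bmul x := by
    induction x with
    | zero => simp
    | add x y hx hy => simp only [map_add, hx, hy]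
    | tmul a b =>
    have h : algebraMap k (A ⊗[k] B) (counit (R := k) (a ⊗ₜ[k] b)) =
        algebraMap k A (counit (R := k) a) ⊗ₜ algebraMap k B (counit (R := k) b) := by
      simp [Algebra.algebraMap_eq_smul_one, Algebra.TensorProduct.one_def, TensorProduct.smul_tmul,
        TensorProduct.tmul_smul, smul_smul, mul_comm]
    rw [h, ← HopfBrace.bantipode_bmul, ← HopfBrace.bantipode_bmul, TensorProduct.comul_tmul]
    induction comul (R := k) a with
    | zero => simp only [map_zero, TensorProduct.zero_tmul]
    | add x y hx hy => simp only [map_add, TensorProduct.add_tmul, hx, hy]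
    | tmul a₁ a₂ =>
    induction comul (R := k) b with
    | zero => simp only [map_zero, TensorProduct.tmul_zero]
    | add x y hx hy => simp only [map_add, TensorProduct.tmul_add, hx, hy]
    | tmul b₁ b₂ => simp
  bmul_bantipode x := by
    induction x with
    | zero => simp
    | add x y hx hy => simp only [map_add, hx, hy]
    | tmul a b =>
    have h : algebraMap k (A ⊗[k] B) (counit (R := k) (a ⊗ₜ[k] b)) =
        algebraMap k A (counit (R := k) a) ⊗ₜ algebraMap k B (counit (R := k) b) := by
      simp [Algebra.algebraMap_eq_smul_one, Algebra.TensorProduct.one_def, TensorProduct.smul_tmul,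
        TensorProduct.tmul_smul, smul_smul, mul_comm]
    rw [h, ← HopfBrace.bmul_bantipode, ← HopfBrace.bmul_bantipode, TensorProduct.comul_tmul]
    induction comul (R := k) a with
    | zero => simp only [map_zero, TensorProduct.zero_tmul]
    | add x y hx hy => simp only [map_add, TensorProduct.add_tmul, hx, hy]
    | tmul a₁ a₂ =>
    induction comul (R := k) b with
    | zero => simp only [map_zero, TensorProduct.tmul_zero]
    | add x y hx hy => simp only [map_add, TensorProduct.tmul_add, hx, hy]
    | tmul b₁ b₂ => simp
  bmul_mul x y z := by
    induction x with
    | zero => simp only [map_zero, LinearMap.zero_apply]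
    | add x y hx hy => simp only [map_add, LinearMap.add_apply, hx, hy]
    | tmul a b =>
    induction y with
    | zero => simp only [map_zero, zero_mul, TensorProduct.map_zero_left, LinearMap.zero_apply]
    | add x y hx hy =>
      simp only [map_add, add_mul, hx, hy, TensorProduct.map_add_left, LinearMap.add_apply]
    | tmul c d =>
    induction z with
    | zero => simp only [map_zero, mul_zero, LinearMap.comp_zero, TensorProduct.map_zero_right,
        LinearMap.zero_apply]
    | add x y hx hy =>
      simp only [map_add, mul_add, hx, hy, TensorProduct.map_add_right, LinearMap.comp_add,
        LinearMap.add_apply]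
    | tmul e f => exact tensor_bmul_mul_tmul A B a c e b d f

/-- The product of two cocommutative Hopf braces is their tensor product. -/
def prod : HBRcoc.{v} k := { carrier := A ⊗[k] B }

/-- The map `a ⊗ b ↦ ε(b) a` of Hopf algebras. -/
def fstBialgHom : A ⊗[k] B →ₐc[k] A :=
  (Bialgebra.TensorProduct.rid k k A : A ⊗[k] k →ₐc[k] A).comp
    (Bialgebra.TensorProduct.map (BialgHom.id k A) (Bialgebra.counitBialgHom k B))

/-- The map `a ⊗ b ↦ ε(a) b` of Hopf algebras. -/
def sndBialgHom : A ⊗[k] B →ₐc[k] B :=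
  (Bialgebra.TensorProduct.lid k B : k ⊗[k] B →ₐc[k] B).comp
    (Bialgebra.TensorProduct.map (Bialgebra.counitBialgHom k A) (BialgHom.id k B))

lemma fstBialgHom_tmul (a : A) (b : B) :
    fstBialgHom A B (a ⊗ₜ[k] b) = counit (R := k) b • a := rfl

lemma sndBialgHom_tmul (a : A) (b : B) :
    sndBialgHom A B (a ⊗ₜ[k] b) = counit (R := k) a • b := rfl

lemma tensor_bmul (x y : A ⊗[k] B) : HopfBrace.bmul (k := k) x y =
    TensorProduct.map₂ (HopfBrace.bmul (k := k)) (HopfBrace.bmul (k := k)) x y := rfl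

/-- The first projection `a ⊗ b ↦ ε(b) a`. -/
def prodFst : prod A B ⟶ A where
  hom := fstBialgHom A B
  map_bmul (x y : A ⊗[k] B) := by
    change fstBialgHom A B (HopfBrace.bmul (k := k) x y) =
      HopfBrace.bmul (k := k) (fstBialgHom A B x) (fstBialgHom A B y)
    rw [tensor_bmul]
    induction x with
    | zero => simp only [map_zero, LinearMap.zero_apply]
    | add x y hx hy => simp only [map_add, LinearMap.add_apply, hx, hy]
    | tmul a b =>
    induction y with
    | zero => simp only [map_zero]
    | add x y hx hy => simp only [map_add, hx, hy]
    | tmul c d =>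
    simp [fstBialgHom_tmul, HopfBrace.counit_bmul, smul_smul, mul_comm]

/-- The second projection `a ⊗ b ↦ ε(a) b`. -/
def prodSnd : prod A B ⟶ B where
  hom := sndBialgHom A B
  map_bmul (x y : A ⊗[k] B) := by
    change sndBialgHom A B (HopfBrace.bmul (k := k) x y) =
      HopfBrace.bmul (k := k) (sndBialgHom A B x) (sndBialgHom A B y)
    rw [tensor_bmul]
    induction x with
    | zero => simp only [map_zero, LinearMap.zero_apply]
    | add x y hx hy => simp only [map_add, LinearMap.add_apply, hx, hy]
    | tmul a b =>
    induction y with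
    | zero => simp only [map_zero]
    | add x y hx hy => simp only [map_add, hx, hy]
    | tmul c d =>
    simp [sndBialgHom_tmul, HopfBrace.counit_bmul, smul_smul, mul_comm]

variable {A B} {C : HBRcoc.{v} k}

/-- The morphism `c ↦ f(c₁) ⊗ g(c₂)` into the product. -/
def prodLift (f : C ⟶ A) (g : C ⟶ B) : C ⟶ prod A B where
  hom := (Bialgebra.TensorProduct.map f.hom g.hom).comp (Bialgebra.comulBialgHom k C)
  map_bmul x y := by
    change TensorProduct.map (f.hom : C →ₗ[k] A) (g.hom : C →ₗ[k] B)
      (comul (R := k) (HopfBrace.bmul (k := k) x y)) = TensorProduct.map₂ _ _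
      (TensorProduct.map (f.hom : C →ₗ[k] A) (g.hom : C →ₗ[k] B) (comul (R := k) x))
      (TensorProduct.map (f.hom : C →ₗ[k] A) (g.hom : C →ₗ[k] B) (comul (R := k) y))
    rw [HopfBrace.comul_bmul]
    induction comul (R := k) x with
    | zero => simp only [map_zero, LinearMap.zero_apply]
    | add x y hx hy => simp only [map_add, LinearMap.add_apply, hx, hy]
    | tmul x₁ x₂ =>
    induction comul (R := k) y with
    | zero => simp only [map_zero]
    | add x y hx hy => simp only [map_add, hx, hy]
    | tmul y₁ y₂ => simp [f.map_bmul, g.map_bmul]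

lemma prodLift_apply (f : C ⟶ A) (g : C ⟶ B) (c : C) : (prodLift f g).hom c =
    TensorProduct.map (f.hom : C →ₗ[k] A) (g.hom : C →ₗ[k] B) (comul (R := k) c) := rfl

lemma prodLift_fst (f : C ⟶ A) (g : C ⟶ B) : prodLift f g ≫ prodFst A B = f := by
  refine hom_ext fun c => ?_
  have h : c = TensorProduct.rid k C (counit.lTensor C (comul (R := k) c)) := by simp
  conv_rhs => rw [h]
  rw [comp_hom_apply, prodLift_apply]
  induction comul (R := k) c with
  | zero => simp only [map_zero]; exact map_zero _
  | add x y hx hy => simp only [map_add]; exact (map_add _ _ _).trans (congrArg₂ _ hx hy)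
  | tmul x y =>
    rw [TensorProduct.map_tmul]
    refine (fstBialgHom_tmul _ _ _ _).trans ?_
    simp

lemma prodLift_snd (f : C ⟶ A) (g : C ⟶ B) : prodLift f g ≫ prodSnd A B = g := by
  refine hom_ext fun c => ?_
  have h : c = TensorProduct.lid k C (counit.rTensor C (comul (R := k) c)) := by simp
  conv_rhs => rw [h]
  rw [comp_hom_apply, prodLift_apply]
  induction comul (R := k) c with
  | zero => simp only [map_zero]; exact map_zero _
  | add x y hx hy => simp only [map_add]; exact (map_add _ _ _).trans (congrArg₂ _ hx hy)
  | tmul x y =>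
    rw [TensorProduct.map_tmul]
    refine (sndBialgHom_tmul _ _ _ _).trans ?_
    simp

lemma map_prodFst_prodSnd_comul (x : A ⊗[k] B) :
    TensorProduct.map (fstBialgHom A B : A ⊗[k] B →ₗ[k] A)
      (sndBialgHom A B : A ⊗[k] B →ₗ[k] B) (comul (R := k) x) = x := by
  induction x with
  | zero => simp only [map_zero]
  | add x y hx hy => simp only [map_add, hx, hy]
  | tmul a b =>
    have ha : a = TensorProduct.rid k A (counit.lTensor A (comul (R := k) a)) := by simp
    have hb : b = TensorProduct.lid k B (counit.rTensor B (comul (R := k) b)) := by simp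
    conv_rhs => rw [ha, hb]
    rw [TensorProduct.comul_tmul]
    induction comul (R := k) a with
    | zero => simp only [map_zero, TensorProduct.zero_tmul]
    | add x y hx hy => simp only [map_add, TensorProduct.add_tmul, hx, hy]
    | tmul a₁ a₂ =>
    induction comul (R := k) b with
    | zero => simp only [map_zero, TensorProduct.tmul_zero]
    | add x y hx hy => simp only [map_add, TensorProduct.tmul_add, hx, hy]
    | tmul b₁ b₂ =>
    change (counit (R := k) b₁ • a₁) ⊗ₜ[k] (counit (R := k) a₂ • b₂) = _
    simp [TensorProduct.smul_tmul, smul_smul, mul_comm]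

lemma prod_hom_ext {f g : C ⟶ prod A B} (h₁ : f ≫ prodFst A B = g ≫ prodFst A B)
    (h₂ : f ≫ prodSnd A B = g ≫ prodSnd A B) : f = g := by
  have key : ∀ (h : C ⟶ prod A B) (c : C), h.hom c =
      TensorProduct.map ((h ≫ prodFst A B).hom : C →ₗ[k] A)
        ((h ≫ prodSnd A B).hom : C →ₗ[k] B) (comul (R := k) c) := by
    intro h c
    refine (map_prodFst_prodSnd_comul (A := A) (B := B) (h.hom c)).symm.trans ?_
    have h1 := CoalgHomClass.map_comp_comul_apply h.hom c
    refine (congrArg _ h1.symm).trans ?_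
    let H : C →ₗ[k] A ⊗[k] B := (h.hom : C →ₗ[k] prod A B)
    exact (LinearMap.congr_fun (TensorProduct.map_comp (fstBialgHom A B : A ⊗[k] B →ₗ[k] A)
      (sndBialgHom A B : A ⊗[k] B →ₗ[k] B) H H) (comul (R := k) c)).symm
  refine hom_ext fun c => ?_
  rw [key f, key g, h₁, h₂]

end Product

/-! ### The zero object -/

section Trivial
open HopfAlgebra

/-- The trivial Hopf brace `a • b = a b` on the one-dimensional Hopf algebra. -/
instance trivialHopfBrace : HopfBrace k (MonoidAlgebra k PUnit.{v + 1}) where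
  bmul := LinearMap.mul k _
  bantipode := antipode k
  bmul_assoc := mul_assoc
  one_bmul := one_mul
  bmul_one := mul_one
  counit_bmul a b := Bialgebra.counit_mul a b
  comul_bmul a b := by
    rw [LinearMap.mul_apply', Bialgebra.comul_mul]
    generalize comul (R := k) a = s
    generalize comul (R := k) b = t
    induction s with
    | zero => rw [map_zero, LinearMap.zero_apply, zero_mul]
    | add x y hx hy => rw [map_add, LinearMap.add_apply, ← hx, ← hy, add_mul]
    | tmul x y =>
    induction t with
    | zero => rw [map_zero, mul_zero]
    | add z w hz hw => rw [map_add, ← hz, ← hw, mul_add]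
    | tmul z w => simp
  bantipode_bmul a := mul_antipode_rTensor_comul_apply a
  bmul_bantipode a := mul_antipode_lTensor_comul_apply a
  bmul_mul a b c := by
    have h : ∀ z : MonoidAlgebra k PUnit.{v + 1} ⊗[k] MonoidAlgebra k PUnit.{v + 1},
      LinearMap.mul' k _ (TensorProduct.map ((LinearMap.mul k _).flip b)
        (LinearMap.mul' k _ ∘ₗ TensorProduct.map (antipode k) ((LinearMap.mul k _).flip c))
        (comul.lTensor _ z)) = LinearMap.mul' k _ (TensorProduct.map LinearMap.id
        (LinearMap.mulRight k (b * c) ∘ₗ Algebra.linearMap k _ ∘ₗ counit) z) := by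
      intro z
      induction z with
      | zero => simp only [map_zero]
      | add x y hx hy => simp only [map_add, hx, hy]
      | tmul x y =>
        simp only [LinearMap.lTensor_tmul, TensorProduct.map_tmul, LinearMap.comp_apply,
          Algebra.linearMap_apply, ← mul_antipode_rTensor_comul_apply, LinearMap.mul'_apply]
        induction comul (R := k) y with
        | zero => simp
        | add x y hx hy => simp only [map_add, mul_add, hx, hy]
        | tmul y z =>
          simp
          ring
    rw [h]
    have h2 : a = TensorProduct.rid k _ (counit.lTensor _ (comul (R := k) a)) := by simp
    conv_lhs => rw [h2]
    induction comul (R := k) a with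
    | zero => simp
    | add x y hx hy => simp only [map_add, LinearMap.add_apply, hx, hy]
    | tmul x y => simp [Algebra.algebraMap_eq_smul_one]

variable (k) in
/-- The zero object. -/
def zeroObj : HBRcoc.{max u v} k := { carrier := MonoidAlgebra k PUnit.{v + 1} }

lemma zeroObj_apply (a : MonoidAlgebra k PUnit.{v + 1}) :
    a = algebraMap k _ (counit (R := k) a) := by
  induction a using MonoidAlgebra.induction_linear with
  | zero => simp
  | add x y hx hy => rw [map_add, map_add, ← hx, ← hy]
  | single g r => simp

lemma isZero_zeroObj : IsZero (zeroObj.{v} k) where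
  unique_to _ := ⟨⟨⟨0⟩, fun f => hom_ext fun a =>
    (congrArg f.hom (zeroObj_apply (k := k) a)).trans (AlgHomClass.commutes f.hom _)⟩⟩
  unique_from _ := ⟨⟨⟨0⟩, fun f => hom_ext fun a =>
    (zeroObj_apply (k := k) (f.hom a)).trans
      (congrArg _ (CoalgHomClass.counit_comp_apply f.hom a))⟩⟩

instance : HasZeroObject (HBRcoc.{max u v} k) := ⟨_, isZero_zeroObj⟩
end Trivial

/-! ### Finite limits -/

section FiniteLimits

instance : HasEqualizers (HBRcoc.{v} k) :=
  have : ∀ {A B : HBRcoc.{v} k} {f g : A ⟶ B}, HasLimit (parallelPair f g) := fun {A _ f g} =>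
    ⟨⟨⟨_, Fork.IsLimit.mk' (Fork.ofι (eqSub f g).ι (ι_eqSub_condition f g)) fun s =>
      ⟨(exists_lift_eqSub s.ι s.condition).choose,
        (exists_lift_eqSub s.ι s.condition).choose_spec, fun hm => hom_ext fun a =>
          (eqSub f g).ι_injective (congrArg (fun h : s.pt ⟶ A => h.hom a)
            (hm.trans (exists_lift_eqSub s.ι s.condition).choose_spec.symm))⟩⟩⟩⟩
  hasEqualizers_of_hasLimit_parallelPair _

instance : HasBinaryProducts (HBRcoc.{v} k) :=
  have : ∀ {A B : HBRcoc.{v} k}, HasLimit (pair A B) := fun {A B} =>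
    ⟨⟨⟨BinaryFan.mk (prodFst A B) (prodSnd A B), BinaryFan.isLimitMk
      (fun s => prodLift s.fst s.snd) (fun s => prodLift_fst s.fst s.snd)
      (fun s => prodLift_snd s.fst s.snd) fun s _ h₁ h₂ => prod_hom_ext
        (h₁.trans (prodLift_fst s.fst s.snd).symm) (h₂.trans (prodLift_snd s.fst s.snd).symm)⟩⟩⟩
  hasBinaryProducts_of_hasLimit_pair _

instance : HasFiniteLimits (HBRcoc.{max u v} k) :=
  have : HasTerminal (HBRcoc.{max u v} k) := HasZeroObject.hasTerminal
  have : HasFiniteProducts (HBRcoc.{max u v} k) := hasFiniteProducts_of_has_binary_and_terminal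
  hasFiniteLimits_of_hasEqualizers_and_finite_products

end FiniteLimits

/-! ### Monomorphisms and regular epimorphisms -/

variable {A B C : HBRcoc.{v} k}

lemma mono_of_injective (f : A ⟶ B) (hf : Function.Injective f.hom) : Mono f where
  right_cancellation _ _ h := hom_ext fun c => hf (congrArg (fun h : _ ⟶ B => h.hom c) h)

lemma epi_of_surjective (f : A ⟶ B) (hf : Function.Surjective f.hom) : Epi f where
  left_cancellation _ _ h := hom_ext fun b => by
    obtain ⟨a, rfl⟩ := hf b
    exact congrArg (fun h : A ⟶ _ => h.hom a) h

/-- Every morphism is a surjective morphism followed by an injective one. -/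
lemma exists_surjective_injective_fac (f : A ⟶ B) :
    ∃ (I : HBRcoc.{v} k) (p : A ⟶ I) (i : I ⟶ B),
      Function.Surjective p.hom ∧ Function.Injective i.hom ∧ p ≫ i = f := by
  obtain ⟨p, hp⟩ := exists_lift_of_injective (image f).ι (image f).ι_injective f
    fun a => (image f).exists_ι ((mem_image f).2 ⟨a, rfl⟩)
  refine ⟨_, p, (image f).ι, fun b => ?_, (image f).ι_injective, hp⟩
  obtain ⟨a, ha⟩ := (mem_image f).1 ((image f).ι_mem b)
  refine ⟨a, (image f).ι_injective ?_⟩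
  exact (congrArg (fun h : A ⟶ B => h.hom a) hp).trans ha

/-- A morphism that vanishes on the categorical kernel of `f` is trivial on its Hopf kernel. -/
lemma apply_of_mem_coinv {f : A ⟶ B} {h : A ⟶ C} (w : (eqSub f 0).ι ≫ h = 0) {x : A}
    (hx : x ∈ coinv f.hom) : h.hom x = algebraMap k C (counit (R := k) x) := by
  obtain ⟨y, rfl⟩ := (eqSub f 0).exists_ι (mem_eqSub_zero.2 hx)
  refine (congrArg (fun h : _ ⟶ C => h.hom y) w).trans ?_
  rw [CoalgHomClass.counit_comp_apply]
  rfl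

/-- A surjective morphism is the cokernel of its kernel. -/
theorem nonempty_normalEpi_of_surjective (p : A ⟶ B) (hp : Function.Surjective p.hom) :
    Nonempty (NormalEpi p) := by
  have := epi_of_surjective p hp
  obtain ⟨s, hs, hs'⟩ := exists_colinear_section p.hom hp
  have key : ∀ {C : HBRcoc.{v} k} (h : A ⟶ C), (eqSub p 0).ι ≫ h = 0 → ∃ l, p ≫ l = h :=
    fun {C} h w => exists_desc_of_surjective p hp h (fun b => h.hom (s b)) fun a =>
      apply_section_of_coinv (C := C) p.hom hs hs' (h.hom : A →ₐ[k] C)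
        (fun x hx => apply_of_mem_coinv w hx) a
  have w : (eqSub p 0).ι ≫ p = 0 := by rw [ι_eqSub_condition, comp_zero]
  exact ⟨{ W := _, g := (eqSub p 0).ι, w := w
           isColimit := CokernelCofork.IsColimit.ofπ' p w fun h hh =>
            ⟨(key h hh).choose, (key h hh).choose_spec⟩ }⟩

/-- A morphism with trivial kernel is injective: with `p` its surjective part, the identity is
trivial on the Hopf kernel of `p` and hence factors through `p`. -/
theorem injective_of_comp_eq_zero (f : A ⟶ B)
    (h : ∀ {L : HBRcoc.{v} k} (l : L ⟶ A), l ≫ f = 0 → l = 0) : Function.Injective f.hom := by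
  obtain ⟨I, p, i, hp, hi, rfl⟩ := exists_surjective_injective_fac f
  obtain ⟨s, hs, hs'⟩ := exists_colinear_section p.hom hp
  have w : (eqSub p 0).ι ≫ 𝟙 A = 0 := by
    rw [Category.comp_id]
    apply h
    rw [← Category.assoc, ι_eqSub_condition, comp_zero, zero_comp]
  have key : ∀ a, s (p.hom a) = a :=
    apply_section_of_coinv p.hom hs hs' (AlgHom.id k A) fun x hx => apply_of_mem_coinv w hx
  intro a b hab
  exact (key a).symm.trans ((congrArg s (hi hab)).trans (key b))

/-- Injective morphisms are clearly monic; conversely, a monomorphism has trivial kernel. -/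
theorem mono_iff_injective (f : A ⟶ B) : Mono f ↔ Function.Injective f.hom :=
  ⟨fun _ => injective_of_comp_eq_zero f fun _ w => zero_of_comp_mono f w,
    mono_of_injective f⟩

lemma isIso_of_bijective (f : A ⟶ B) (hf : Function.Bijective f.hom) : IsIso f := by
  have := mono_of_injective f hf.1
  obtain ⟨g, hg⟩ := exists_lift_of_injective f hf.1 (𝟙 B) hf.2
  exact ⟨g, by rw [← cancel_mono f, Category.assoc, hg, Category.comp_id, Category.id_comp], hg⟩

/-- A regular epimorphism does not factor through a proper subobject of its target, and the image
is a subobject. -/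
theorem isRegularEpi_iff_surjective (f : A ⟶ B) :
    IsRegularEpi f ↔ Function.Surjective f.hom := by
  refine ⟨fun _ => ?_, fun hf => ?_⟩
  · obtain ⟨I, p, i, hp, hi, hpi⟩ := exists_surjective_injective_fac f
    have := mono_of_injective i hi
    have : IsIso i := ExtremalEpi.isIso (f := f) p i hpi
    intro b
    obtain ⟨a, ha⟩ := hp ((inv i).hom b)
    refine ⟨a, ?_⟩
    rw [← hpi, comp_hom_apply, ha, ← comp_hom_apply, IsIso.inv_hom_id, id_hom_apply]
  · obtain ⟨_⟩ := nonempty_normalEpi_of_surjective f hf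
    infer_instance

theorem isRegularEpi_iff_normalEpi (f : A ⟶ B) : IsRegularEpi f ↔ Nonempty (NormalEpi f) :=
  ⟨fun h => nonempty_normalEpi_of_surjective f ((isRegularEpi_iff_surjective f).1 h),
    fun ⟨_⟩ => inferInstance⟩

/-! ### Regularity -/

section Pullback
variable {X Y : HBRcoc.{v} k}

lemma coact_prodFst_comp (g : X ⟶ Y) (z : X ⊗[k] B) :
    coact (prodFst X B ≫ g).hom z =
      (TensorProduct.rightComm k X Y B) ((coact g.hom).toLinearMap.rTensor B z) := by
  let G : X ⊗[k] B →ₗ[k] Y := ((prodFst X B ≫ g).hom : prod X B →ₗ[k] Y)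
  change G.lTensor (X ⊗[k] B) (comul (R := k) z) = _
  induction z with
  | zero => simp only [map_zero]
  | add x y hx hy => simp only [map_add, hx, hy]
  | tmul x b =>
  have hb : b = TensorProduct.rid k B (counit.lTensor B (comul (R := k) b)) := by simp
  conv_rhs => rw [hb]
  rw [LinearMap.rTensor_tmul, AlgHom.toLinearMap_apply, coact_apply]
  rw [TensorProduct.comul_tmul]
  induction comul (R := k) x with
  | zero => simp only [map_zero, TensorProduct.zero_tmul]
  | add x y hx hy => simp only [map_add, TensorProduct.add_tmul, hx, hy]
  | tmul x₁ x₂ =>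
  induction comul (R := k) b with
  | zero => simp only [map_zero, TensorProduct.tmul_zero]
  | add x y hx hy => simp only [map_add, TensorProduct.tmul_add, hx, hy]
  | tmul b₁ b₂ =>
  change (x₁ ⊗ₜ[k] b₁) ⊗ₜ[k] g.hom (counit (R := k) b₂ • x₂) =
    (x₁ ⊗ₜ[k] (counit (R := k) b₂ • b₁)) ⊗ₜ[k] g.hom x₂
  simp [TensorProduct.tmul_smul, TensorProduct.smul_tmul']

lemma coact_prodSnd_comp (f : B ⟶ Y) (z : X ⊗[k] B) :
    coact (prodSnd X B ≫ f).hom z =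
      (TensorProduct.assoc k X B Y).symm ((coact f.hom).toLinearMap.lTensor X z) := by
  let G : X ⊗[k] B →ₗ[k] Y := ((prodSnd X B ≫ f).hom : prod X B →ₗ[k] Y)
  change G.lTensor (X ⊗[k] B) (comul (R := k) z) = _
  induction z with
  | zero => simp only [map_zero]
  | add x y hx hy => simp only [map_add, hx, hy]
  | tmul x b =>
  have hx : x = TensorProduct.rid k X (counit.lTensor X (comul (R := k) x)) := by simp
  conv_rhs => rw [hx]
  rw [LinearMap.lTensor_tmul, AlgHom.toLinearMap_apply, coact_apply]
  rw [TensorProduct.comul_tmul]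
  induction comul (R := k) x with
  | zero => simp only [map_zero, TensorProduct.zero_tmul]
  | add x y hx hy => simp only [map_add, TensorProduct.add_tmul, hx, hy]
  | tmul x₁ x₂ =>
  induction comul (R := k) b with
  | zero => simp only [map_zero, TensorProduct.tmul_zero]
  | add x y hx hy => simp only [map_add, TensorProduct.tmul_add, hx, hy]
  | tmul b₁ b₂ =>
  change (x₁ ⊗ₜ[k] b₁) ⊗ₜ[k] f.hom (counit (R := k) x₂ • b₂) =
    ((counit (R := k) x₂ • x₁) ⊗ₜ[k] b₁) ⊗ₜ[k] f.hom b₂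
  simp [TensorProduct.tmul_smul, TensorProduct.smul_tmul']

/-- For a colinear section `s` of `g`, the element `s(f(b₁)) ⊗ b₂` lies in the pullback of `g`
and `f`. -/
lemma section_mem_eqSub (g : X ⟶ Y) (f : B ⟶ Y) {s : Y →ₗ[k] X}
    (hs : ∀ y, coact g.hom (s y) = s.rTensor Y (comul (R := k) y)) (b : B) :
    (s ∘ₗ (f.hom : B →ₗ[k] Y)).rTensor B (comul (R := k) b) ∈
      (eqSub (prodFst X B ≫ g) (prodSnd X B ≫ f)).toSubalgebra := by
  refine mem_eqSub.2 ((coact_prodFst_comp g _).trans (Eq.trans ?_ (coact_prodSnd_comp f _).symm))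
  let Ψ : B ⊗[k] (B ⊗[k] B) →ₗ[k] (X ⊗[k] B) ⊗[k] Y :=
    (TensorProduct.assoc k X B Y).symm.toLinearMap ∘ₗ
      TensorProduct.map (s ∘ₗ (f.hom : B →ₗ[k] Y)) ((f.hom : B →ₗ[k] Y).lTensor B)
  have h₁ : ∀ z : B ⊗[k] B, (TensorProduct.rightComm k X Y B)
      ((coact g.hom).toLinearMap.rTensor B ((s ∘ₗ (f.hom : B →ₗ[k] Y)).rTensor B z)) =
      Ψ ((TensorProduct.comm k B B).toLinearMap.lTensor B
        (TensorProduct.assoc k B B B (comul.rTensor B z))) := by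
    intro z
    induction z with
    | zero => simp only [map_zero]
    | add x y hx hy => simp only [map_add, hx, hy]
    | tmul x y =>
    have hf : comul (R := k) (f.hom x) = TensorProduct.map (f.hom : B →ₗ[k] Y) (f.hom : B →ₗ[k] Y)
      (comul (R := k) x) := (CoalgHomClass.map_comp_comul_apply f.hom x).symm
    have hx : coact g.hom (s (f.hom x)) = s.rTensor Y (TensorProduct.map (f.hom : B →ₗ[k] Y)
      (f.hom : B →ₗ[k] Y) (comul (R := k) x)) := (hs _).trans (congrArg _ hf)
    rw [LinearMap.rTensor_tmul, LinearMap.rTensor_tmul, LinearMap.rTensor_tmul]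
    refine (congrArg (fun t => TensorProduct.rightComm k X Y B (t ⊗ₜ y)) hx).trans ?_
    induction comul (R := k) x with
    | zero => simp only [map_zero, TensorProduct.zero_tmul]
    | add x y hx hy => simp only [map_add, TensorProduct.add_tmul, hx, hy]
    | tmul x₁ x₂ => rfl
  have h₂ : ∀ z : B ⊗[k] B, (TensorProduct.assoc k X B Y).symm ((coact f.hom).toLinearMap.lTensor X
      ((s ∘ₗ (f.hom : B →ₗ[k] Y)).rTensor B z)) = Ψ (comul.lTensor B z) := by
    intro z
    induction z with
    | zero => simp only [map_zero]
    | add x y hx hy => simp only [map_add, hx, hy]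
    | tmul x y => rfl
  rw [h₁, h₂, coassoc_apply, ← LinearMap.lTensor_comp_apply, comm_comp_comul]

/-- Surjections are stable under pullback: `b` is the projection of `s(f(b₁)) ⊗ b₂`. -/
lemma surjective_of_isPullback {P : HBRcoc.{v} k} {f' : P ⟶ X} {g' : P ⟶ B} {g : X ⟶ Y}
    {f : B ⟶ Y} (sq : IsPullback f' g' g f) (hg : Function.Surjective g.hom) :
    Function.Surjective g'.hom := by
  obtain ⟨s, hs, hs'⟩ := exists_colinear_section g.hom hg
  intro b
  let E := eqSub (prodFst X B ≫ g) (prodSnd X B ≫ f)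
  obtain ⟨e, he⟩ := E.exists_ι (section_mem_eqSub g f hs' b)
  have w : (E.ι ≫ prodFst X B) ≫ g = (E.ι ≫ prodSnd X B) ≫ f := by
    simpa using ι_eqSub_condition (prodFst X B ≫ g) (prodSnd X B ≫ f)
  refine ⟨(sq.lift _ _ w).hom e, ?_⟩
  rw [← comp_hom_apply, sq.lift_snd, comp_hom_apply, he]
  have hε : ∀ y, counit (R := k) (s y) = counit (R := k) y := fun y => by
    rw [← CoalgHomClass.counit_comp_apply g.hom, hs]
  have h : b = TensorProduct.lid k B (counit.rTensor B (comul (R := k) b)) := by simp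
  conv_rhs => rw [h]
  induction comul (R := k) b with
  | zero => simp only [map_zero]; exact map_zero _
  | add x y hx hy => simp only [map_add]; exact (map_add _ _ _).trans (congrArg₂ _ hx hy)
  | tmul x y =>
    refine (sndBialgHom_tmul _ _ _ _).trans ?_
    simp [hε]

end Pullback

lemma regular : Regular (HBRcoc.{max u v} k) where
  hasCoequalizer_of_isKernelPair {X Y Z f g₁ g₂} h := by
    obtain ⟨I, p, i, hp, hi, rfl⟩ := exists_surjective_injective_fac f
    have := mono_of_injective i hi
    have := (isRegularEpi_iff_surjective p).2 hp
    exact ⟨⟨⟨_, h.cancel_right_of_mono.toCoequalizer'⟩⟩⟩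
  regularEpiIsStableUnderBaseChange :=
    { of_isPullback := fun sq hg => (isRegularEpi_iff_surjective _).2
        (surjective_of_isPullback sq ((isRegularEpi_iff_surjective _).1 hg)) }

/-! ### The Split Short Five Lemma -/

section Split
open WithConv HopfAlgebra

/-- A subalgebra containing the Hopf kernel of `f` and the image of a splitting `s` is everything: `c = (c₁ S(s(f(c₂)))) s(f(c₃))`, and the first factor lies in the Hopf kernel. -/
lemma mem_of_split (f : A ⟶ B) (s : B ⟶ A) (hs : s ≫ f = 𝟙 B) (U : Subalgebra k A)
    (h₁ : ∀ x ∈ coinv f.hom, x ∈ U) (h₂ : ∀ b, s.hom b ∈ U) (c : A) : c ∈ U := by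
  have hcol : ∀ b, coact f.hom (s.hom b) = (s.hom : B →ₗ[k] A).rTensor B (comul (R := k) b) := by
    intro b
    rw [coact_comp, hs]
    congr 1
    exact LinearMap.lTensor_id_apply _ _ _
  let q : A →ₐ[k] A := (s.hom : B →ₐ[k] A).comp (f.hom : A →ₐ[k] B)
  let κ : WithConv (A →ₗ[k] A) := toConv LinearMap.id * toConv (q.toLinearMap ∘ₗ antipode k)
  -- `κ(a) = a₁ S(q(a₂))` is the value at `S(a)` of `c ↦ S(c₁) q(c₂)`
  have hκ : ∀ a, κ a ∈ U := by
    intro a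
    have := h₁ _ (antipode_mul_section_mem_coinv f.hom hcol (antipode k a))
    rw [comul_antipode, ← LinearMap.comp_apply (TensorProduct.map _ _), ← TensorProduct.map_comp,
      antipode_antipode] at this
    exact this
  have h3 : κ * toConv q.toLinearMap = toConv LinearMap.id := by
    rw [mul_assoc, toConv_comp_antipode_mul_algHom, mul_one]
  have h4 : c = (κ * toConv q.toLinearMap) c := by rw [h3]; rfl
  rw [h4, LinearMap.convMul_apply]
  induction comul (R := k) c with
  | zero => simp
  | add x y hx hy => simp only [map_add]; exact U.add_mem hx hy
  | tmul x y => exact U.mul_mem (hκ x) (h₂ _)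

theorem splitShortFiveLemma : SplitShortFiveLemma (HBRcoc.{v} k) := by
  rintro K A B K' A' B' i f s i' f' s' u v w hs hs' ⟨hi, ⟨li⟩⟩ ⟨hi', ⟨li'⟩⟩ h₁ h₂ h₃ _ _
  refine isIso_of_bijective v ⟨injective_of_comp_eq_zero v fun {L} l hl => ?_, fun c => ?_⟩
  · have hlf : l ≫ f = 0 := by
      rw [← cancel_mono w, Category.assoc, h₂, ← Category.assoc, hl, zero_comp, zero_comp]
    obtain ⟨t, rfl⟩ : ∃ t, t ≫ i = l := ⟨_, (KernelFork.IsLimit.lift' li l hlf).2⟩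
    have : Mono i' := ⟨fun _ _ => Fork.IsLimit.hom_ext li'⟩
    have ht : t = 0 := by
      rw [← cancel_mono u, ← cancel_mono i', Category.assoc, ← h₁, ← Category.assoc, hl,
        zero_comp, zero_comp]
    rw [ht, zero_comp]
  · refine (mem_image v).1 (mem_of_split f' s' hs' _ (fun x hx => ?_) (fun b => ?_) c)
    · have hk : (eqSub f' 0).ι ≫ f' = 0 := by rw [ι_eqSub_condition, comp_zero]
      obtain ⟨t, ht⟩ : ∃ t, t ≫ i' = (eqSub f' 0).ι := ⟨_, (KernelFork.IsLimit.lift' li' _ hk).2⟩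
      obtain ⟨y, rfl⟩ := (eqSub f' 0).exists_ι (mem_eqSub_zero.2 hx)
      refine ⟨(t ≫ inv u ≫ i).hom y, ?_⟩
      change ((t ≫ inv u ≫ i) ≫ v).hom y = _
      rw [← ht]
      simp [h₁]
    · refine ⟨(inv w ≫ s).hom b, ?_⟩
      change ((inv w ≫ s) ≫ v).hom b = _
      simp [h₃]

end Split
end HBRcoc

end

theorem theorem3p9 (k : Type u) [Field k] :
    IsHomological (HBRcoc.{max u v} k) ∧
    (∀ {A B : HBRcoc.{max u v} k} (f : A ⟶ B),
      ∃ (I : HBRcoc.{max u v} k) (p : A ⟶ I) (i : I ⟶ B),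
        Nonempty (NormalEpi p) ∧ Mono i ∧ p ≫ i = f) ∧
    (∀ {A B : HBRcoc.{max u v} k} (f : A ⟶ B),
      (IsRegularEpi f ↔ Nonempty (NormalEpi f)) ∧
      (IsRegularEpi f ↔ Function.Surjective f.hom)) ∧
    (∀ {A B : HBRcoc.{max u v} k} (f : A ⟶ B),
      Mono f ↔ Function.Injective f.hom) := by
  refine ⟨⟨inferInstance, HBRcoc.regular, HBRcoc.splitShortFiveLemma⟩, fun f => ?_, fun f =>
    ⟨HBRcoc.isRegularEpi_iff_normalEpi f, HBRcoc.isRegularEpi_iff_surjective f⟩,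
    HBRcoc.mono_iff_injective⟩
  obtain ⟨I, p, i, hp, hi, h⟩ := HBRcoc.exists_surjective_injective_fac f
  exact ⟨I, p, i, HBRcoc.nonempty_normalEpi_of_surjective p hp, HBRcoc.mono_of_injective i hi, h⟩
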